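/- **Setting.** A *function* $f$ is a sequence of let-bindings $\mathtt{let}\ x:m = e\ \mathtt{in}\ \dots$ ending in a returned expression $r_f$. Expressions are built from variables, rational constants, negation, $+,-,*,/$, $\mathrm{FMA}(e_1,e_2,e_3)=e_1*e_2+e_3$ and casts; constants, casts and let-bindings are annotated with a precision. The precisions are $\infty$ (exact reals), 16-, 32- and 64-bit floating point with machine epsilon $\varepsilon_m = 2^{-11},2^{-24},2^{-53}$, and fixed-point formats with word length $w$ and $b$ fractional bits. *Semantics.* Representing $v$ in precision $m$ may give $v$ if $m=\infty$, any $v+v\delta$ with $|\delta|\le\varepsilon_m$ if $m$ is floating point, any $v+\delta$ with $|\delta|\le 2^{-b}$ if $m$ is fixed point; write $\mathrm{error}(v,m)$ for the largest absolute deviation, i.e. $0$, $|v|\varepsilon_m$, $2^{-b}$ respectively. Given an environment $E$ (a partial map from variables to reals) and a partial type map $\mathcal T$ from expressions to precisions, $(e,E,\mathcal T)\Downarrow(v,m)$ is the big-step relation in which every evaluated expression has the precision $m$ given by $\mathcal T$; variables are looked up in $E$; constants, casts and the results of $+,-,*,/$ (division only by a nonzero value) and FMA are represented in that precision, which for $+,-,*,/$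 and FMA has to be the join $\sqcup$ of the precisions of the operands (the most precise one; for fixed-point operands any fixed-point format whose word length is not smaller; floating-point and fixed-point operands do not mix); negation is exact. A let-binding evaluates $e$ in the annotated precision, which must also be $\mathcal T(x)$, and extends $E$. The real-valued execution of $f$ is that of $f$ with $\infty$ for the precision of all variables, constants, operations, casts and let-bindings; $\tilde f$ is $f$ with its annotated precisions. *Approximation relation.* $E\sim_{(\mathcal E,fV,dV,\mathcal T)}\tilde E$ is the least relation such that the empty environments are related for $fV=dV=\emptyset$, and such that if $E\sim_{(\mathcal E,fV,dV,\mathcal T)}\tilde E$, $x\notin fV\cup dV$ and $\mathcal T(x)=m$, then $E[x\mapsto v]$ and $\tilde E[x\mapsto\tilde v]$ are related for $(\mathcal E,\{x\}\cup fV,dV,\mathcal T)$ whenever $|v-\tilde v|\le\mathrm{error}(v,m)$, and for $(\mathcal E,fV,\{x\}\cup dV,\mathcal T)$ whenever $|v-\tilde v|\le\mathcal E(x)$. *Certificate and validators.* A certificate consists of $f$, intervals $P(x)$ with rational end points for the input variables, a partial type map $\Gamma$, and partial maps $\mathcal R$ and $\mathcal E$ from expressions to rational intervals and to rational error bounds.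 (i) The type validator $\mathtt{validTypes}(\Gamma,f)$ returns the type map that extends $\Gamma$ to all subexpressions of $f$: floating-point result types are inferred as joins, fixed-point result types of operations are taken from $\Gamma$; it fails if a type is missing, incompatible with the operands or the annotations, or different from the one in $\Gamma$. (ii) The real range validator $\mathtt{validRanges}(f,P,\mathcal R)$ recomputes, with interval arithmetic or (if that fails) with affine arithmetic, an enclosure of the range of every subexpression $e$, starting from $P$ for variables in $fV$ and from $\mathcal R$ for variables in $dV$, and checks that it is contained in $\mathcal R(e)$ and that no divisor range contains $0$; for a let-binding the enclosure for the bound expression must be contained in $\mathcal R(x)$. (iii) The machine range validator $\mathtt{validFPRanges}(f,\mathcal T,\mathcal R,\mathcal E)$ checks for every subexpression $e$ (other than let-bound variables) that all values of $\mathcal R(e)$ widened by $\mathcal E(e)$ are within the range of finite values of the precision $\mathcal T(e)$ and, for floating point, that this interval contains a normal number or is $\{0\}$. (iv) The error validator $\mathtt{validErrors}(f,\mathcal T,\mathcal R,\mathcal E)$ checks for every subexpression $e$ that $\mathcal E(e)\ge 0$ and, unless $e$ is a let-bound variable, that $\mathcal E(e)$ is at least the error propagated from the operands plus the new rounding error on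 the widened operand ranges, and that no widened divisor range contains $0$; for a let-binding the error bound of the bound expression must be at most $\mathcal E(x)$. **Theorem (overall soundness of FloVer).** Let $f$ be a function, $E,\tilde E$ environments, $fV,dV$ finite sets of variables, $P$, $\Gamma$, $\mathcal R$, $\mathcal E$ as above, and $\mathcal T$ a type map. Assume that $f$ is in SSA form over $fV\cup dV$ (it uses only variables in $fV\cup dV$ and variables that are let-bound before their use, and no variable is defined twice), that $E(x)\in P(x)$ for all $x\in fV$ and $E(x)\in\mathcal R(x)$ for all $x\in dV$, and that $$E\sim_{(\mathcal E,fV,dV,\mathcal T)}\tilde E,\quad \mathtt{validTypes}(\Gamma,f)=\mathcal T,\quad \mathtt{validRanges}(f,P,\mathcal R),\quad \mathtt{validFPRanges}(f,\mathcal T,\mathcal R,\mathcal E),\quad \mathtt{validErrors}(f,\mathcal T,\mathcal R,\mathcal E).$$ Then the error bound $\mathcal E(f):=\mathcal E(r_f)$ of the returned expression is defined, and there are $v,\tilde v_1\in\mathbb R$ and a precision $m_1$ such that $(f,E,\mathcal T)\Downarrow(v,\infty)$ in the real-valued execution, $(\tilde f,\tilde E,\mathcal T)\Downarrow(\tilde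 v_1,m_1)$, and for all $\tilde v_2,m_2$ with $(\tilde f,\tilde E,\mathcal T)\Downarrow(\tilde v_2,m_2)$ we have $|v-\tilde v_2|\le\mathcal E(f)$. -/

import Mathlib

namespace FloVer

/-! ## Precisions -/

/-- Machine types: infinite precision (`real`), IEEE 754 binary16/32/64 and fixed-point formats
with word length `w` and `f` fractional bits. -/
inductive MType where
  | real
  | f16
  | f32
  | f64
  | fixed (w f : ℕ)
  deriving DecidableEq

namespace MType

def isFixed : MType → Bool
  | fixed _ _ => true
  | _ => false

/-- For floating-point types the machine epsilon (a bound on the relative error of one rounding to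
nearest), for fixed-point types the distance of neighbouring values (a bound on the absolute error
of one truncation). -/
def eps : MType → ℚ
  | real => 0
  | f16 => (1 / 2) ^ 11
  | f32 => (1 / 2) ^ 24
  | f64 => (1 / 2) ^ 53
  | fixed _ f => (1 / 2) ^ f

/-- `m.Rounds v v'`: `v'` is a possible result of representing the real number `v` in `m`, that is
`v' = v + error (v, m)`. -/
def Rounds : MType → ℝ → ℝ → Prop
  | real, v, v' => v' = v
  | fixed w f, v, v' => ∃ δ : ℝ, |δ| ≤ ((fixed w f).eps : ℝ) ∧ v' = v + δ
  | m, v, v' => ∃ δ : ℝ, |δ| ≤ (m.eps : ℝ) ∧ v' = v + v * δ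

/-- Largest absolute value of `error (v, m)`. -/
noncomputable def error : MType → ℝ → ℝ
  | real, _ => 0
  | fixed w f, _ => ((fixed w f).eps : ℝ)
  | m, v => |v| * (m.eps : ℝ)

/-- `m.errorQ a` bounds `error (v, m)` for all `v` with `|v| ≤ a`, computed on rationals. -/
def errorQ : MType → ℚ → ℚ
  | real, _ => 0
  | fixed w f, _ => (fixed w f).eps
  | m, a => a * m.eps

/-- `m.atLeast m'`: `m` is at least as precise as `m'`. Floating-point and fixed-point types are
not comparable; fixed-point types are compared by word length, the position of the radix point
being part of the (externally inferred) format. -/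
def atLeast : MType → MType → Bool
  | real, _ => true
  | f64, f64 => true
  | f64, f32 => true
  | f64, f16 => true
  | f32, f32 => true
  | f32, f16 => true
  | f16, f16 => true
  | fixed w _, fixed w' _ => decide (w' ≤ w)
  | _, _ => false

/-- `m = m₁ ⊔ m₂`. For floating-point types `m` is the more precise one of `m₁`, `m₂`; for
fixed-point operands any fixed-point format with enough bits is a possible result format. -/
def isJoin (m₁ m₂ m : MType) : Bool :=
  m.atLeast m₁ && m.atLeast m₂ && (decide (m = m₁) || decide (m = m₂) || m.isFixed)

/-- `m = m₁ ⊔ m₂ ⊔ m₃`. -/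
def isJoin₃ (m₁ m₂ m₃ m : MType) : Bool :=
  m.atLeast m₁ && m.atLeast m₂ && m.atLeast m₃ &&
    (decide (m = m₁) || decide (m = m₂) || decide (m = m₃) || m.isFixed)

/-- Inference of `m₁ ⊔ m₂`; not available for fixed-point operands. -/
def join (m₁ m₂ : MType) : Option MType :=
  if m₁.isFixed && m₂.isFixed then none
  else if m₁.atLeast m₂ then some m₁
  else if m₂.atLeast m₁ then some m₂
  else none

end MType

/-! ## Programs -/

inductive BinOp where
  | add
  | sub
  | mul
  | div
  deriving DecidableEq

/-- Arithmetic expressions; constants and casts are annotated with their precision. -/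
inductive Expr where
  | var (x : ℕ)
  | const (m : MType) (q : ℚ)
  | neg (e : Expr)
  | binop (op : BinOp) (e₁ e₂ : Expr)
  | fma (e₁ e₂ e₃ : Expr)
  | cast (m : MType) (e : Expr)
  deriving DecidableEq

/-- Functions: `letin m x e s` is `let x : m := e in s`. -/
inductive Cmd where
  | letin (m : MType) (x : ℕ) (e : Expr) (s : Cmd)
  | ret (e : Expr)

def Expr.vars : Expr → Finset ℕ
  | .var x => {x}
  | .const _ _ => ∅
  | .neg e => e.vars
  | .binop _ e₁ e₂ => e₁.vars ∪ e₂.vars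
  | .fma e₁ e₂ e₃ => e₁.vars ∪ e₂.vars ∪ e₃.vars
  | .cast _ e => e.vars

/-- The expression whose value a function returns. -/
def Cmd.result : Cmd → Expr
  | .letin _ _ _ s => s.result
  | .ret e => e

/-- `f.isSSA V`: the function only uses variables in `V` and previously let-bound ones, and no
variable is defined twice. -/
def Cmd.isSSA : Cmd → Finset ℕ → Bool
  | .letin _ x e s, V => decide (x ∉ V) && decide (e.vars ⊆ V) && s.isSSA (insert x V)
  | .ret e, V => decide (e.vars ⊆ V)

/-- The idealized real-valued version: all constants and casts have infinite precision. -/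
def Expr.toReal : Expr → Expr
  | .var x => .var x
  | .const _ q => .const .real q
  | .neg e => .neg e.toReal
  | .binop op e₁ e₂ => .binop op e₁.toReal e₂.toReal
  | .fma e₁ e₂ e₃ => .fma e₁.toReal e₂.toReal e₃.toReal
  | .cast _ e => .cast .real e.toReal

def Cmd.toReal : Cmd → Cmd
  | .letin _ x e s => .letin .real x e.toReal s.toReal
  | .ret e => .ret e.toReal

/-! ## Semantics -/

/-- (Partial) type maps from expressions to precisions. -/
abbrev TypeMap := Expr → Option MType

abbrev Env := ℕ → Option ℝ

/-- The type map of the real-valued execution: every typed variable and every operation gets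
infinite precision. -/
def TypeMap.toReal (τ : TypeMap) : TypeMap
  | .var x => (τ (.var x)).map fun _ => .real
  | _ => some .real

noncomputable def BinOp.eval : BinOp → ℝ → ℝ → ℝ
  | .add, a, b => a + b
  | .sub, a, b => a - b
  | .mul, a, b => a * b
  | .div, a, b => a / b

/-- Big-step semantics of expressions, `(e, E, τ) ⇓ (v, m)`. -/
inductive Expr.Eval (E : Env) (τ : TypeMap) : Expr → ℝ → MType → Prop where
  | var {x : ℕ} {v : ℝ} {m : MType} :
      τ (.var x) = some m → E x = some v → Expr.Eval E τ (.var x) v m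
  | const {m : MType} {q : ℚ} {v : ℝ} :
      τ (.const m q) = some m → m.Rounds (q : ℝ) v → Expr.Eval E τ (.const m q) v m
  | neg {e : Expr} {v : ℝ} {m : MType} :
      τ (.neg e) = some m → Expr.Eval E τ e v m → Expr.Eval E τ (.neg e) (-v) m
  | binop {op : BinOp} {e₁ e₂ : Expr} {v₁ v₂ v : ℝ} {m₁ m₂ m : MType} :
      τ (.binop op e₁ e₂) = some m →
      Expr.Eval E τ e₁ v₁ m₁ → Expr.Eval E τ e₂ v₂ m₂ →
      MType.isJoin m₁ m₂ m = true →
      (op = .div → v₂ ≠ 0) →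
      m.Rounds (op.eval v₁ v₂) v →
      Expr.Eval E τ (.binop op e₁ e₂) v m
  | fma {e₁ e₂ e₃ : Expr} {v₁ v₂ v₃ v : ℝ} {m₁ m₂ m₃ m : MType} :
      τ (.fma e₁ e₂ e₃) = some m →
      Expr.Eval E τ e₁ v₁ m₁ → Expr.Eval E τ e₂ v₂ m₂ → Expr.Eval E τ e₃ v₃ m₃ →
      MType.isJoin₃ m₁ m₂ m₃ m = true →
      m.Rounds (v₁ * v₂ + v₃) v →
      Expr.Eval E τ (.fma e₁ e₂ e₃) v m
  | cast {m m₁ : MType} {e : Expr} {v₁ v : ℝ} :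
      τ (.cast m e) = some m → Expr.Eval E τ e v₁ m₁ → m.Rounds v₁ v →
      Expr.Eval E τ (.cast m e) v m

/-- Big-step semantics of functions, `(f, E, τ) ⇓ (v, m)`. -/
inductive Cmd.Eval (τ : TypeMap) : Cmd → Env → ℝ → MType → Prop where
  | letin {m : MType} {x : ℕ} {e : Expr} {s : Cmd} {E : Env} {v v' : ℝ} {m' : MType} :
      Expr.Eval E τ e v m → τ (.var x) = some m →
      Cmd.Eval τ s (Function.update E x (some v)) v' m' →
      Cmd.Eval τ (.letin m x e s) E v' m'
  | ret {e : Expr} {E : Env} {v : ℝ} {m : MType} :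
      Expr.Eval E τ e v m → Cmd.Eval τ (.ret e) E v m

/-! ## Intervals -/

structure Intv where
  lo : ℚ
  hi : ℚ

namespace Intv

/-- Membership of a real number. -/
def Mem (I : Intv) (v : ℝ) : Prop := (I.lo : ℝ) ≤ v ∧ v ≤ (I.hi : ℝ)

/-- `I.subset J`: the bounds of `I` lie within those of `J`. -/
def subset (I J : Intv) : Bool := decide (J.lo ≤ I.lo) && decide (I.hi ≤ J.hi)

def point (q : ℚ) : Intv := ⟨q, q⟩

def neg (I : Intv) : Intv := ⟨-I.hi, -I.lo⟩

def add (I J : Intv) : Intv := ⟨I.lo + J.lo, I.hi + J.hi⟩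

def sub (I J : Intv) : Intv := ⟨I.lo - J.hi, I.hi - J.lo⟩

def mul (I J : Intv) : Intv :=
  ⟨min (min (I.lo * J.lo) (I.lo * J.hi)) (min (I.hi * J.lo) (I.hi * J.hi)),
   max (max (I.lo * J.lo) (I.lo * J.hi)) (max (I.hi * J.lo) (I.hi * J.hi))⟩

/-- Inverse of an interval that does not contain zero. -/
def inv (I : Intv) : Intv := ⟨1 / I.hi, 1 / I.lo⟩

def div (I J : Intv) : Intv := I.mul J.inv

def noZero (I : Intv) : Bool := decide (I.hi < 0) || decide (0 < I.lo)

def widen (I : Intv) (err : ℚ) : Intv := ⟨I.lo - err, I.hi + err⟩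

def maxAbs (I : Intv) : ℚ := max |I.lo| |I.hi|

/-- Smallest absolute value in an interval that does not contain zero. -/
def minAbs (I : Intv) : ℚ := min |I.lo| |I.hi|

end Intv

def BinOp.intv : BinOp → Intv → Intv → Intv
  | .add => Intv.add
  | .sub => Intv.sub
  | .mul => Intv.mul
  | .div => Intv.div

/-! ## The certificate -/

/-- Interval constraints on the input variables. -/
abbrev Precond := ℕ → Intv

/-- Range analysis results. -/
abbrev RangeMap := Expr → Option Intv

/-- Error analysis results. -/
abbrev ErrorMap := Expr → Option ℚ

/-- The approximation relation between a real-valued and a finite-precision environment, for free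
variables `fV` and let-bound variables `dV`. -/
inductive ApproxEnv (Err : ErrorMap) (τ : TypeMap) :
    Env → Finset ℕ → Finset ℕ → Env → Prop where
  | empty : ApproxEnv Err τ (fun _ => none) ∅ ∅ (fun _ => none)
  | freeVar {E E' : Env} {fV dV : Finset ℕ} {x : ℕ} {m : MType} {v v' : ℝ} :
      ApproxEnv Err τ E fV dV E' → x ∉ fV ∪ dV →
      τ (.var x) = some m → |v - v'| ≤ m.error v →
      ApproxEnv Err τ (Function.update E x (some v)) (insert x fV) dV
        (Function.update E' x (some v'))
  | definedVar {E E' : Env} {fV dV : Finset ℕ} {x : ℕ} {m : MType} {err : ℚ} {v v' : ℝ} :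
      ApproxEnv Err τ E fV dV E' → x ∉ fV ∪ dV →
      τ (.var x) = some m → Err (.var x) = some err → |v - v'| ≤ (err : ℝ) →
      ApproxEnv Err τ (Function.update E x (some v)) fV (insert x dV)
        (Function.update E' x (some v'))

/-! ## Type validator -/

/-- Record the type `m` for `e`, provided that `Γ` assigns no other type to `e`. -/
def addType (Γ : TypeMap) (e : Expr) (m : MType) (τ : TypeMap) : Option TypeMap :=
  if Γ e = none ∨ Γ e = some m then some (Function.update τ e (some m)) else none

/-- Extends the type map `τ` computed so far by the types of all subexpressions of an expression.
The result type of an operation is the one in `Γ` if present and is inferred otherwise. -/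
def Expr.inferTypes (Γ : TypeMap) : Expr → TypeMap → Option TypeMap
  | .var x, τ =>
    if (τ (.var x)).isSome then some τ
    else (Γ (.var x)).bind fun m => addType Γ (.var x) m τ
  | .const m q, τ =>
    if (τ (.const m q)).isSome then some τ else addType Γ (.const m q) m τ
  | .neg e, τ =>
    if (τ (.neg e)).isSome then some τ
    else (e.inferTypes Γ τ).bind fun τ₁ => (τ₁ e).bind fun m => addType Γ (.neg e) m τ₁
  | .binop op e₁ e₂, τ =>
    if (τ (.binop op e₁ e₂)).isSome then some τ
    else (e₁.inferTypes Γ τ).bind fun τ₁ => (e₂.inferTypes Γ τ₁).bind fun τ₂ =>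
      (τ₂ e₁).bind fun m₁ => (τ₂ e₂).bind fun m₂ =>
      ((Γ (.binop op e₁ e₂)).or (MType.join m₁ m₂)).bind fun m =>
      if MType.isJoin m₁ m₂ m then addType Γ (.binop op e₁ e₂) m τ₂ else none
  | .fma e₁ e₂ e₃, τ =>
    if (τ (.fma e₁ e₂ e₃)).isSome then some τ
    else (e₁.inferTypes Γ τ).bind fun τ₁ => (e₂.inferTypes Γ τ₁).bind fun τ₂ =>
      (e₃.inferTypes Γ τ₂).bind fun τ₃ =>
      (τ₃ e₁).bind fun m₁ => (τ₃ e₂).bind fun m₂ => (τ₃ e₃).bind fun m₃ =>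
      ((Γ (.fma e₁ e₂ e₃)).or ((MType.join m₁ m₂).bind fun m₁₂ => MType.join m₁₂ m₃)).bind fun m =>
      if MType.isJoin₃ m₁ m₂ m₃ m then addType Γ (.fma e₁ e₂ e₃) m τ₃ else none
  | .cast m e, τ =>
    if (τ (.cast m e)).isSome then some τ
    else (e.inferTypes Γ τ).bind fun τ₁ => addType Γ (.cast m e) m τ₁

/-- A let-binding needs the annotated precision to be that of the bound expression. -/
def Cmd.inferTypes (Γ : TypeMap) : Cmd → TypeMap → Option TypeMap
  | .letin m x e s, τ =>
    (e.inferTypes Γ τ).bind fun τ₁ =>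
      if τ₁ e = some m ∧ τ₁ (.var x) = none then
        (addType Γ (.var x) m τ₁).bind fun τ₂ => s.inferTypes Γ τ₂
      else none
  | .ret e, τ => e.inferTypes Γ τ

/-- The type validator: computes the full type map of `f` from the partial type map `Γ`. -/
def validTypes (Γ : TypeMap) (f : Cmd) : Option TypeMap :=
  f.inferTypes Γ fun _ => none

/-! ## Real range validator -/

/-- `R e` is defined and encloses the interval `I`. -/
def RangeMap.encloses (R : RangeMap) (e : Expr) (I : Intv) : Bool :=
  match R e with
  | some J => I.subset J
  | none => false

/-- Range check of an expression with interval arithmetic; `dV` are the variables whose ranges have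
been validated already. -/
def Expr.checkIA (P : Precond) (R : RangeMap) (dV : Finset ℕ) : Expr → Bool
  | .var x => if x ∈ dV then (R (.var x)).isSome else R.encloses (.var x) (P x)
  | .const m q => R.encloses (.const m q) (.point q)
  | .neg e => e.checkIA P R dV &&
    match R e with
    | some I => R.encloses (.neg e) I.neg
    | none => false
  | .binop op e₁ e₂ => e₁.checkIA P R dV && e₂.checkIA P R dV &&
    match R e₁, R e₂ with
    | some I₁, some I₂ =>
      (decide (op ≠ .div) || I₂.noZero) && R.encloses (.binop op e₁ e₂) (op.intv I₁ I₂)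
    | _, _ => false
  | .fma e₁ e₂ e₃ => e₁.checkIA P R dV && e₂.checkIA P R dV && e₃.checkIA P R dV &&
    match R e₁, R e₂, R e₃ with
    | some I₁, some I₂, some I₃ => R.encloses (.fma e₁ e₂ e₃) ((I₁.mul I₂).add I₃)
    | _, _, _ => false
  | .cast m e => e.checkIA P R dV &&
    match R e with
    | some I => R.encloses (.cast m e) I
    | none => false

def Cmd.checkIA (P : Precond) (R : RangeMap) : Cmd → Finset ℕ → Bool
  | .letin _ x e s, dV => e.checkIA P R dV &&
    (match R e with
    | some I => R.encloses (.var x) I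
    | none => false) && s.checkIA P R (insert x dV)
  | .ret e, dV => e.checkIA P R dV

/-- Affine forms `center + ∑ i, noise[i] * ε i` with noise symbols `ε i ∈ [-1, 1]`. -/
structure AffForm where
  center : ℚ
  noise : List ℚ

namespace AffForm

def addNoise : List ℚ → List ℚ → List ℚ
  | [], bs => bs
  | as, [] => as
  | a :: as, b :: bs => (a + b) :: addNoise as bs

def const (q : ℚ) : AffForm := ⟨q, []⟩

/-- The form `r * ε n`. -/
def symbol (n : ℕ) (r : ℚ) : AffForm := ⟨0, List.replicate n 0 ++ [r]⟩

def add (a b : AffForm) : AffForm := ⟨a.center + b.center, addNoise a.noise b.noise⟩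

def scale (q : ℚ) (a : AffForm) : AffForm := ⟨q * a.center, a.noise.map (q * ·)⟩

def neg (a : AffForm) : AffForm := a.scale (-1)

def radius (a : AffForm) : ℚ := (a.noise.map (|·|)).sum

def toIntv (a : AffForm) : Intv := ⟨a.center - a.radius, a.center + a.radius⟩

/-- All numbers in `I`, by means of the fresh noise symbol `n`. -/
def ofIntv (I : Intv) (n : ℕ) : AffForm :=
  (const ((I.lo + I.hi) / 2)).add (symbol n ((I.hi - I.lo) / 2))

/-- Product, with the fresh noise symbol `n` for the nonlinear part. -/
def mul (a b : AffForm) (n : ℕ) : AffForm :=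
  ((const (a.center * b.center)).add
    ((AffForm.scale a.center ⟨0, b.noise⟩).add (AffForm.scale b.center ⟨0, a.noise⟩))).add
    (symbol n (a.radius * b.radius))

/-- Linear approximation of `1 / a` for `a` in `[l, h]`, `0 < l`: on this interval
`1 / x + x / h ^ 2` is between `2 / h` and `1 / l + l / h ^ 2`. -/
def invPos (a : AffForm) (n : ℕ) : AffForm :=
  let l := a.toIntv.lo
  let h := a.toIntv.hi
  let top := 1 / l + l / h ^ 2
  let bot := 2 / h
  ((a.scale (-(1 / h ^ 2))).add (const ((top + bot) / 2))).add (symbol n ((top - bot) / 2))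

/-- Inverse of a form whose range does not contain zero, with the fresh noise symbol `n`. -/
def inv (a : AffForm) (n : ℕ) : AffForm :=
  if 0 < a.toIntv.lo then a.invPos n else (a.neg.invPos n).neg

end AffForm

/-- Operations on affine forms; the noise symbols `n` and `n + 1` are fresh. -/
def BinOp.aff : BinOp → AffForm → AffForm → ℕ → AffForm
  | .add, a, b, _ => a.add b
  | .sub, a, b, _ => a.add b.neg
  | .mul, a, b, n => a.mul b n
  | .div, a, b, n => a.mul (b.inv n) (n + 1)

/-- State of the affine range check: the forms of the expressions checked so far, and the number of
noise symbols in use. -/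
structure AffState where
  form : Expr → Option AffForm
  next : ℕ

/-- Record the form `a` for `e`, provided that its range is enclosed by `R e`. -/
def AffState.record (R : RangeMap) (e : Expr) (a : AffForm) (form : Expr → Option AffForm)
    (next : ℕ) : Option AffState :=
  if R.encloses e a.toIntv then some ⟨Function.update form e (some a), next⟩ else none

/-- Range check of an expression with affine arithmetic. -/
def Expr.checkAA (P : Precond) (R : RangeMap) (dV : Finset ℕ) : Expr → AffState → Option AffState
  | .var x, st =>
    if (st.form (.var x)).isSome then some st
    else if x ∈ dV then (R (.var x)).bind fun I =>
      some ⟨Function.update st.form (.var x) (some (.ofIntv I st.next)), st.next + 1⟩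
    else AffState.record R (.var x) (.ofIntv (P x) st.next) st.form (st.next + 1)
  | .const m q, st =>
    if (st.form (.const m q)).isSome then some st
    else AffState.record R (.const m q) (.const q) st.form st.next
  | .neg e, st =>
    if (st.form (.neg e)).isSome then some st
    else (e.checkAA P R dV st).bind fun st₁ => (st₁.form e).bind fun a =>
      AffState.record R (.neg e) a.neg st₁.form st₁.next
  | .binop op e₁ e₂, st =>
    if (st.form (.binop op e₁ e₂)).isSome then some st
    else (e₁.checkAA P R dV st).bind fun st₁ => (e₂.checkAA P R dV st₁).bind fun st₂ =>
      (st₂.form e₁).bind fun a₁ => (st₂.form e₂).bind fun a₂ =>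
      if decide (op ≠ .div) || a₂.toIntv.noZero then
        AffState.record R (.binop op e₁ e₂) (op.aff a₁ a₂ st₂.next) st₂.form (st₂.next + 2)
      else none
  | .fma e₁ e₂ e₃, st =>
    if (st.form (.fma e₁ e₂ e₃)).isSome then some st
    else (e₁.checkAA P R dV st).bind fun st₁ => (e₂.checkAA P R dV st₁).bind fun st₂ =>
      (e₃.checkAA P R dV st₂).bind fun st₃ =>
      (st₃.form e₁).bind fun a₁ => (st₃.form e₂).bind fun a₂ => (st₃.form e₃).bind fun a₃ =>
      AffState.record R (.fma e₁ e₂ e₃) ((a₁.mul a₂ st₃.next).add a₃) st₃.form (st₃.next + 1)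
  | .cast m e, st =>
    if (st.form (.cast m e)).isSome then some st
    else (e.checkAA P R dV st).bind fun st₁ => (st₁.form e).bind fun a =>
      AffState.record R (.cast m e) a st₁.form st₁.next

/-- A let-bound variable inherits the affine form of the bound expression. -/
def Cmd.checkAA (P : Precond) (R : RangeMap) : Cmd → Finset ℕ → AffState → Option AffState
  | .letin _ x e s, dV, st =>
    (e.checkAA P R dV st).bind fun st₁ => (st₁.form e).bind fun a =>
      (AffState.record R (.var x) a st₁.form st₁.next).bind fun st₂ =>
      s.checkAA P R (insert x dV) st₂
  | .ret e, dV, st => e.checkAA P R dV st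

/-- The real range validator: the ranges are confirmed by interval or by affine arithmetic. `dV` is
the set of variables let-bound outside of `f`. -/
def validRanges (f : Cmd) (P : Precond) (R : RangeMap) (dV : Finset ℕ) : Bool :=
  f.checkIA P R dV || (f.checkAA P R dV ⟨fun _ => none, 0⟩).isSome

/-! ## Machine range validator -/

/-- For a floating-point type: all values in the interval are finite (the largest finite binary
floating-point number with `p` significant bits and maximal exponent `E` is `(2 - 2 ^ (1 - p)) * 2 ^
E`), and a normal number is among them unless they are all zero. For a fixed-point type: all values
in the interval are within the representable range. -/
def MType.fits : MType → Intv → Bool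
  | .real, _ => true
  | .f16, I => decide (I.maxAbs ≤ (2 - (1 / 2) ^ 10) * 2 ^ 15) &&
      (decide ((1 / 2) ^ 14 ≤ I.maxAbs) || decide (I.maxAbs = 0))
  | .f32, I => decide (I.maxAbs ≤ (2 - (1 / 2) ^ 23) * 2 ^ 127) &&
      (decide ((1 / 2) ^ 126 ≤ I.maxAbs) || decide (I.maxAbs = 0))
  | .f64, I => decide (I.maxAbs ≤ (2 - (1 / 2) ^ 52) * 2 ^ 1023) &&
      (decide ((1 / 2) ^ 1022 ≤ I.maxAbs) || decide (I.maxAbs = 0))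
  | .fixed w f, I => decide (I.maxAbs ≤ (2 ^ (w - 1) - 1) / 2 ^ f)

/-- The finite-precision range of `e` fits its type. -/
def fitsAt (τ : TypeMap) (R : RangeMap) (Err : ErrorMap) (e : Expr) : Bool :=
  match τ e, R e, Err e with
  | some m, some I, some err => m.fits (I.widen err)
  | _, _, _ => false

def Expr.checkFP (τ : TypeMap) (R : RangeMap) (Err : ErrorMap) (dV : Finset ℕ) : Expr → Bool
  | .var x => decide (x ∈ dV) || fitsAt τ R Err (.var x)
  | .const m q => fitsAt τ R Err (.const m q)
  | .neg e => e.checkFP τ R Err dV && fitsAt τ R Err (.neg e)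
  | .binop op e₁ e₂ =>
    e₁.checkFP τ R Err dV && e₂.checkFP τ R Err dV && fitsAt τ R Err (.binop op e₁ e₂)
  | .fma e₁ e₂ e₃ =>
    e₁.checkFP τ R Err dV && e₂.checkFP τ R Err dV && e₃.checkFP τ R Err dV &&
      fitsAt τ R Err (.fma e₁ e₂ e₃)
  | .cast m e => e.checkFP τ R Err dV && fitsAt τ R Err (.cast m e)

/-- The machine range validator: no overflow, and no range consisting of subnormal numbers only. -/
def validFPRanges : Cmd → TypeMap → RangeMap → ErrorMap → Finset ℕ → Bool
  | .letin _ x e s, τ, R, Err, dV =>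
    e.checkFP τ R Err dV && validFPRanges s τ R Err (insert x dV)
  | .ret e, τ, R, Err, dV => e.checkFP τ R Err dV

/-! ## Error validator -/

/-- Propagated error and new rounding error of an operation in precision `m`, for operands with real
ranges `I₁`, `I₂` and errors `err₁`, `err₂`. -/
def BinOp.errorBound (m : MType) (I₁ : Intv) (err₁ : ℚ) (I₂ : Intv) (err₂ : ℚ) : BinOp → ℚ
  | .add => err₁ + err₂ + m.errorQ ((I₁.widen err₁).add (I₂.widen err₂)).maxAbs
  | .sub => err₁ + err₂ + m.errorQ ((I₁.widen err₁).sub (I₂.widen err₂)).maxAbs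
  | .mul => I₁.maxAbs * err₂ + I₂.maxAbs * err₁ + err₁ * err₂ +
      m.errorQ ((I₁.widen err₁).mul (I₂.widen err₂)).maxAbs
  | .div =>
      -- bound on the difference of the real and the finite-precision value of the inverse
      let errInv := err₂ / (I₂.widen err₂).minAbs ^ 2
      I₁.maxAbs * errInv + I₂.inv.maxAbs * err₁ + err₁ * errInv +
        m.errorQ ((I₁.widen err₁).div (I₂.widen err₂)).maxAbs

/-- The analogous bound for a fused multiply-add. -/
def fmaErrorBound (m : MType) (I₁ : Intv) (err₁ : ℚ) (I₂ : Intv) (err₂ : ℚ) (I₃ : Intv)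
    (err₃ : ℚ) : ℚ :=
  I₁.maxAbs * err₂ + I₂.maxAbs * err₁ + err₁ * err₂ + err₃ +
    m.errorQ (((I₁.widen err₁).mul (I₂.widen err₂)).add (I₃.widen err₃)).maxAbs

/-- Error check of an expression; `dV` are the variables whose errors have been validated
already. -/
def Expr.checkError (τ : TypeMap) (R : RangeMap) (Err : ErrorMap) (dV : Finset ℕ) : Expr → Bool
  | .var x =>
    match τ (.var x), R (.var x), Err (.var x) with
    | some m, some I, some err =>
      decide (0 ≤ err) && (decide (x ∈ dV) || decide (m.errorQ I.maxAbs ≤ err))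
    | _, _, _ => false
  | .const m q =>
    match R (.const m q), Err (.const m q) with
    | some I, some err => decide (0 ≤ err) && decide (m.errorQ I.maxAbs ≤ err)
    | _, _ => false
  | .neg e => e.checkError τ R Err dV &&
    match Err e, Err (.neg e) with
    | some err₁, some err => decide (0 ≤ err) && decide (err₁ ≤ err)
    | _, _ => false
  | .binop op e₁ e₂ => e₁.checkError τ R Err dV && e₂.checkError τ R Err dV &&
    match τ (.binop op e₁ e₂), R e₁, Err e₁, R e₂, Err e₂, Err (.binop op e₁ e₂) with
    | some m, some I₁, some err₁, some I₂, some err₂, some err =>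
      decide (0 ≤ err) && (decide (op ≠ .div) || (I₂.widen err₂).noZero) &&
        decide (op.errorBound m I₁ err₁ I₂ err₂ ≤ err)
    | _, _, _, _, _, _ => false
  | .fma e₁ e₂ e₃ =>
    e₁.checkError τ R Err dV && e₂.checkError τ R Err dV && e₃.checkError τ R Err dV &&
    match τ (.fma e₁ e₂ e₃), R e₁, Err e₁, R e₂, Err e₂, R e₃, Err e₃, Err (.fma e₁ e₂ e₃) with
    | some m, some I₁, some err₁, some I₂, some err₂, some I₃, some err₃, some err =>
      decide (0 ≤ err) && decide (fmaErrorBound m I₁ err₁ I₂ err₂ I₃ err₃ ≤ err)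
    | _, _, _, _, _, _, _, _ => false
  | .cast m e => e.checkError τ R Err dV &&
    match R e, Err e, Err (.cast m e) with
    | some I₁, some err₁, some err =>
      decide (0 ≤ err) && decide (err₁ + m.errorQ (I₁.widen err₁).maxAbs ≤ err)
    | _, _, _ => false

/-- The error validator. `dV` is the set of variables let-bound outside of `f`. -/
def validErrors : Cmd → TypeMap → RangeMap → ErrorMap → Finset ℕ → Bool
  | .letin _ x e s, τ, R, Err, dV => e.checkError τ R Err dV &&
    (match Err e, Err (.var x) with
    | some err₁, some err => decide (err₁ ≤ err)
    | _, _ => false) && validErrors s τ R Err (insert x dV)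
  | .ret e, τ, R, Err, dV => e.checkError τ R Err dV

end FloVer

/-! The idealized and the finite-precision execution run over the same syntax, so structural
induction controls both. Three facts are established, each feeding the next.

Types: a successful type check yields a map in which every typed expression is consistent with its
operands (`TypeMap.Closed`), so typing the bound and returned expressions types everything below
them (`validTypes_sound`). As each precision is read off the map, all executions of an expression
have the same type.

Ranges: the real value of every subexpression exists and lies in `R` (`rangeSound_of_validRanges`).
For interval arithmetic this is local to each operation. For affine arithmetic the invariant is
global: one valuation of the noise symbols in [-1, 1] makes every recorded form equal to the exact
real value of its expression. Each nonlinear operation chooses the value of a fresh symbol, which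
leaves earlier forms unchanged.

Errors: existence of a finite-precision execution and the bound on all such executions are proved
together (`Expr.errorSound_of_checkError`). The bound places the machine divisor in the widened
range, which excludes 0, so division can proceed; rounding with δ = 0 then supplies a result. Real
operands lie in their ranges and machine operands in the widened ranges, hence the propagated error
and the new rounding error add up to the checked bound (`BinOp.abs_sub_le_errorBound`,
`abs_sub_le_fmaErrorBound`).

For a let-binding the possible machine values are not unique. The induction in
`Cmd.sound_of_validErrors` therefore ranges over all machine environments close to the real one. -/

namespace FloVer

/-! ## Rounding -/

namespace MType

theorem eps_nonneg (m : MType) : (0 : ℝ) ≤ (m.eps : ℝ) := by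
  cases m <;> simp [eps]

/-- The deviation 0 is always admissible; this supplies the results when an execution has to be
exhibited. -/
theorem rounds_self (m : MType) (v : ℝ) : m.Rounds v v := by
  have h := m.eps_nonneg
  cases m
  case real => rfl
  all_goals exact ⟨0, by simpa using h, by simp⟩

theorem abs_sub_le_error {m : MType} {v v' : ℝ} (h : m.Rounds v v') : |v - v'| ≤ m.error v := by
  cases m
  case real => simp [Rounds] at h; simp [h, error]
  case fixed w f =>
    obtain ⟨δ, hδ, rfl⟩ := h
    simpa [error] using hδ
  all_goals
    obtain ⟨δ, hδ, rfl⟩ := h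
    simpa [error, abs_mul] using mul_le_mul_of_nonneg_left hδ (abs_nonneg v)

theorem error_le_errorQ (m : MType) {v : ℝ} {a : ℚ} (h : |v| ≤ (a : ℝ)) :
    m.error v ≤ (m.errorQ a : ℝ) := by
  cases m
  case real => simp [error, errorQ]
  case fixed w f => simp [error, errorQ]
  all_goals
    simp only [error, errorQ, Rat.cast_mul]
    exact mul_le_mul_of_nonneg_right h (eps_nonneg _)

theorem abs_sub_le_errorQ {m : MType} {v v' : ℝ} {a : ℚ} (h : m.Rounds v v')
    (ha : |v| ≤ (a : ℝ)) : |v - v'| ≤ (m.errorQ a : ℝ) :=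
  (abs_sub_le_error h).trans (m.error_le_errorQ ha)

end MType

/-! ## Intervals -/

/-- Multiplication by a fixed `y` is monotone or antitone according to the sign of `y`, so its
extremes are at the end points. -/
theorem mul_mem_endpoints {a b x : ℝ} (y : ℝ) (ha : a ≤ x) (hb : x ≤ b) :
    min (a * y) (b * y) ≤ x * y ∧ x * y ≤ max (a * y) (b * y) := by
  rcases le_total 0 y with hy | hy
  · exact ⟨min_le_of_left_le (mul_le_mul_of_nonneg_right ha hy),
      le_max_of_le_right (mul_le_mul_of_nonneg_right hb hy)⟩
  · exact ⟨min_le_of_right_le (mul_le_mul_of_nonpos_right hb hy),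
      le_max_of_le_left (mul_le_mul_of_nonpos_right ha hy)⟩

namespace Intv

variable {I J : Intv} {v w : ℝ}

theorem Mem.of_subset (h : I.Mem v) (hIJ : I.subset J = true) : J.Mem v := by
  simp only [subset, Bool.and_eq_true, decide_eq_true_eq] at hIJ
  exact ⟨le_trans (by exact_mod_cast hIJ.1) h.1, h.2.trans (by exact_mod_cast hIJ.2)⟩

theorem mem_point (q : ℚ) : (point q).Mem (q : ℝ) := ⟨le_rfl, le_rfl⟩

theorem Mem.neg (h : I.Mem v) : I.neg.Mem (-v) := by
  obtain ⟨h1, h2⟩ := h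
  constructor <;> simp only [Intv.neg] <;> push_cast <;> linarith

theorem Mem.add (h : I.Mem v) (k : J.Mem w) : (I.add J).Mem (v + w) := by
  obtain ⟨h1, h2⟩ := h
  obtain ⟨k1, k2⟩ := k
  constructor <;> simp only [Intv.add] <;> push_cast <;> linarith

theorem Mem.sub (h : I.Mem v) (k : J.Mem w) : (I.sub J).Mem (v - w) := by
  obtain ⟨h1, h2⟩ := h
  obtain ⟨k1, k2⟩ := k
  constructor <;> simp only [Intv.sub] <;> push_cast <;> linarith

theorem Mem.mul (h : I.Mem v) (k : J.Mem w) : (I.mul J).Mem (v * w) := by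
  -- The first factor is moved to its end points, then `w` to the end points of `J` in each of the
  -- two products.
  have key := mul_mem_endpoints w h.1 h.2
  have lo := mul_mem_endpoints (I.lo : ℝ) k.1 k.2
  have hi := mul_mem_endpoints (I.hi : ℝ) k.1 k.2
  simp only [mul_comm _ (I.lo : ℝ), mul_comm _ (I.hi : ℝ)] at lo hi
  constructor
  · simp only [Intv.mul]
    push_cast
    exact (min_le_min lo.1 hi.1).trans key.1
  · simp only [Intv.mul]
    push_cast
    exact key.2.trans (max_le_max lo.2 hi.2)

theorem noZero_iff : I.noZero = true ↔ (I.hi : ℝ) < 0 ∨ 0 < (I.lo : ℝ) := by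
  simp [noZero]

theorem Mem.ne_zero (h : I.Mem v) (h0 : I.noZero = true) : v ≠ 0 := by
  rcases noZero_iff.1 h0 with h0 | h0
  · exact (h.2.trans_lt h0).ne
  · exact (h0.trans_le h.1).ne'

theorem Mem.inv (h : I.Mem v) (h0 : I.noZero = true) : I.inv.Mem v⁻¹ := by
  obtain ⟨h1, h2⟩ := h
  simp only [Mem, Intv.inv, one_div, Rat.cast_inv]
  rcases noZero_iff.1 h0 with h0 | h0
  · exact ⟨(inv_le_inv_of_neg h0 (h2.trans_lt h0)).2 h2,
      (inv_le_inv_of_neg (h2.trans_lt h0) ((h1.trans h2).trans_lt h0)).2 h1⟩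
  · exact ⟨inv_anti₀ (h0.trans_le h1) h2, inv_anti₀ h0 h1⟩

theorem Mem.div (h : I.Mem v) (k : J.Mem w) (k0 : J.noZero = true) : (I.div J).Mem (v / w) := by
  rw [div_eq_mul_inv]
  exact h.mul (k.inv k0)

theorem Mem.widen {err : ℚ} (h : I.Mem v) (hvw : |v - w| ≤ (err : ℝ)) : (I.widen err).Mem w := by
  obtain ⟨h1, h2⟩ := h
  obtain ⟨h3, h4⟩ := abs_le.1 hvw
  constructor <;> simp only [Intv.widen] <;> push_cast <;> linarith

theorem Mem.widen_self {err : ℚ} (h : I.Mem v) (herr : 0 ≤ err) : (I.widen err).Mem v :=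
  h.widen (by simpa using herr)

/-- The error check tests only the widened divisor range, while the bound for the real inverse needs
the original one. -/
theorem noZero_of_widen {err : ℚ} (herr : 0 ≤ err) (h : (I.widen err).noZero = true) :
    I.noZero = true := by
  have herr' : (0 : ℝ) ≤ (err : ℝ) := by exact_mod_cast herr
  rw [noZero_iff] at h ⊢
  simp only [widen, Rat.cast_add, Rat.cast_sub] at h
  exact h.imp (fun h => by linarith) fun h => by linarith

theorem Mem.abs_le (h : I.Mem v) : |v| ≤ (I.maxAbs : ℝ) := by
  simp only [maxAbs, Rat.cast_max, Rat.cast_abs]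
  exact abs_le_max_abs_abs h.1 h.2

theorem Mem.minAbs_le (h : I.Mem v) (h0 : I.noZero = true) : (I.minAbs : ℝ) ≤ |v| := by
  obtain ⟨h1, h2⟩ := h
  simp only [minAbs, Rat.cast_min, Rat.cast_abs]
  rcases noZero_iff.1 h0 with h0 | h0
  · apply min_le_of_right_le
    rw [abs_of_neg h0, abs_of_neg (h2.trans_lt h0)]
    linarith
  · apply min_le_of_left_le
    rw [abs_of_pos h0, abs_of_pos (h0.trans_le h1)]
    exact h1

/-- A member is needed to force `I.lo ≤ I.hi`; `noZero` alone constrains only one end point. -/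
theorem Mem.minAbs_pos (h : I.Mem v) (h0 : I.noZero = true) : 0 < (I.minAbs : ℝ) := by
  obtain ⟨h1, h2⟩ := h
  simp only [minAbs, Rat.cast_min, Rat.cast_abs, lt_min_iff, abs_pos]
  rcases noZero_iff.1 h0 with h0 | h0
  · exact ⟨((h1.trans h2).trans_lt h0).ne, h0.ne⟩
  · exact ⟨h0.ne', (h0.trans_le (h1.trans h2)).ne'⟩

end Intv

theorem BinOp.mem_intv {op : BinOp} {I J : Intv} {v w : ℝ} (h : I.Mem v) (k : J.Mem w)
    (h0 : op = .div → J.noZero = true) : (op.intv I J).Mem (op.eval v w) := by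
  cases op
  · exact h.add k
  · exact h.sub k
  · exact h.mul k
  · exact h.div k (h0 rfl)

theorem RangeMap.exists_of_encloses {R : RangeMap} {e : Expr} {I : Intv} {v : ℝ}
    (h : R.encloses e I = true) (hv : I.Mem v) : ∃ J, R e = some J ∧ J.Mem v := by
  unfold RangeMap.encloses at h
  split at h
  · next J hJ => exact ⟨J, hJ, hv.of_subset h⟩
  · simp at h

/-! ## Real-valued execution -/

/-- The real value of an expression; unbound variables and division by zero get junk values. -/
noncomputable def Expr.realValue (E : Env) : Expr → ℝ
  | .var x => (E x).getD 0
  | .const _ q => q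
  | .neg e => -e.realValue E
  | .binop op e₁ e₂ => op.eval (e₁.realValue E) (e₂.realValue E)
  | .fma e₁ e₂ e₃ => e₁.realValue E * e₂.realValue E + e₃.realValue E
  | .cast _ e => e.realValue E

/-- The real-valued execution of `e` succeeds, with its value in the range given by `R`. -/
def InRange (R : RangeMap) (τ : TypeMap) (E : Env) (e : Expr) : Prop :=
  (∃ I, R e = some I ∧ I.Mem (e.realValue E)) ∧
    e.toReal.Eval E τ.toReal (e.realValue E) .real

/-- All subexpressions of an expression are `InRange`. -/
def Expr.RangeSound (R : RangeMap) (τ : TypeMap) (E : Env) : Expr → Prop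
  | .var x => InRange R τ E (.var x)
  | .const m q => InRange R τ E (.const m q)
  | .neg e => e.RangeSound R τ E ∧ InRange R τ E (.neg e)
  | .binop op e₁ e₂ => e₁.RangeSound R τ E ∧ e₂.RangeSound R τ E ∧ InRange R τ E (.binop op e₁ e₂)
  | .fma e₁ e₂ e₃ => e₁.RangeSound R τ E ∧ e₂.RangeSound R τ E ∧ e₃.RangeSound R τ E ∧
      InRange R τ E (.fma e₁ e₂ e₃)
  | .cast m e => e.RangeSound R τ E ∧ InRange R τ E (.cast m e)

/-- All expressions occurring in the real-valued execution of a function are in range. -/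
def Cmd.RangeSound (R : RangeMap) (τ : TypeMap) : Cmd → Env → Prop
  | .letin _ x e s, E => e.RangeSound R τ E ∧
      s.RangeSound R τ (Function.update E x (some (e.realValue E)))
  | .ret e, E => e.RangeSound R τ E

theorem Expr.RangeSound.inRange {R : RangeMap} {τ : TypeMap} {E : Env} {e : Expr}
    (h : e.RangeSound R τ E) : InRange R τ E e := by
  cases e <;> simp only [Expr.RangeSound] at h <;> tauto

theorem Expr.realValue_congr {E E' : Env} {e : Expr} (h : ∀ x ∈ e.vars, E x = E' x) :
    e.realValue E = e.realValue E' := by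
  induction e with
  | var x => simp [realValue, h x (by simp [vars])]
  | const => rfl
  | neg e ih => simp only [realValue, ih h]
  | binop op e₁ e₂ ih₁ ih₂ =>
    simp only [vars, Finset.mem_union] at h
    simp only [realValue, ih₁ fun x hx => h x (.inl hx), ih₂ fun x hx => h x (.inr hx)]
  | fma e₁ e₂ e₃ ih₁ ih₂ ih₃ =>
    simp only [vars, Finset.mem_union] at h
    simp only [realValue, ih₁ fun x hx => h x (.inl (.inl hx)),
      ih₂ fun x hx => h x (.inl (.inr hx)), ih₃ fun x hx => h x (.inr hx)]
  | cast m e ih => simp only [realValue, ih h]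

theorem Expr.vars_toReal (e : Expr) : e.toReal.vars = e.vars := by
  induction e <;> simp_all [toReal, vars]

theorem Expr.Eval.congr {E E' : Env} {τ : TypeMap} {e : Expr} {v : ℝ} {m : MType}
    (he : e.Eval E τ v m) (h : ∀ x ∈ e.vars, E x = E' x) : e.Eval E' τ v m := by
  induction he with
  | var hτ hE => exact .var hτ (by rw [← h _ (by simp [vars]), hE])
  | const hτ hr => exact .const hτ hr
  | neg hτ _ ih => exact .neg hτ (ih h)
  | binop hτ _ _ hj h0 hr ih₁ ih₂ =>
    simp only [vars, Finset.mem_union] at h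
    exact .binop hτ (ih₁ fun x hx => h x (.inl hx)) (ih₂ fun x hx => h x (.inr hx)) hj h0 hr
  | fma hτ _ _ _ hj hr ih₁ ih₂ ih₃ =>
    simp only [vars, Finset.mem_union] at h
    exact .fma hτ (ih₁ fun x hx => h x (.inl (.inl hx)))
      (ih₂ fun x hx => h x (.inl (.inr hx))) (ih₃ fun x hx => h x (.inr hx)) hj hr
  | cast hτ _ hr ih => exact .cast hτ (ih h) hr

theorem InRange.congr {R : RangeMap} {τ : TypeMap} {E E' : Env} {e : Expr}
    (he : InRange R τ E e) (h : ∀ x ∈ e.vars, E x = E' x) : InRange R τ E' e := by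
  unfold InRange at he ⊢
  rw [← Expr.realValue_congr h]
  exact ⟨he.1, he.2.congr (by rwa [Expr.vars_toReal])⟩

/-- Lets range facts survive the binding of a fresh variable, as needed for the forms cached by the
affine check. -/
theorem Expr.RangeSound.congr {R : RangeMap} {τ : TypeMap} {E E' : Env} {e : Expr}
    (he : e.RangeSound R τ E) (h : ∀ x ∈ e.vars, E x = E' x) : e.RangeSound R τ E' := by
  induction e with
  | var x => exact InRange.congr he h
  | const => exact InRange.congr he h
  | neg e ih => exact ⟨ih he.1 h, he.2.congr h⟩
  | binop op e₁ e₂ ih₁ ih₂ =>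
    refine ⟨ih₁ he.1 fun x hx => h x ?_, ih₂ he.2.1 fun x hx => h x ?_, he.2.2.congr h⟩ <;>
      simp [vars, hx]
  | fma e₁ e₂ e₃ ih₁ ih₂ ih₃ =>
    refine ⟨ih₁ he.1 fun x hx => h x ?_, ih₂ he.2.1 fun x hx => h x ?_,
      ih₃ he.2.2.1 fun x hx => h x ?_, he.2.2.2.congr h⟩ <;> simp [vars, hx]
  | cast m e ih => exact ⟨ih he.1 h, he.2.congr h⟩

/-! ### Introduction rules for range soundness, one per constructor. -/

section RangeIntro

variable {R : RangeMap} {τ : TypeMap} {E : Env}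

theorem InRange.of_var {x : ℕ} {v : ℝ} (hτ : (τ (.var x)).isSome) (hE : E x = some v)
    (hR : ∃ I, R (.var x) = some I ∧ I.Mem v) : InRange R τ E (.var x) := by
  obtain ⟨m, hm⟩ := Option.isSome_iff_exists.1 hτ
  have hv : (Expr.var x).realValue E = v := by simp [Expr.realValue, hE]
  refine ⟨by rwa [hv], ?_⟩
  rw [hv]
  exact .var (by simp [TypeMap.toReal, hm]) hE

theorem Expr.RangeSound.const {m : MType} {q : ℚ}
    (hR : ∃ I, R (.const m q) = some I ∧ I.Mem (q : ℝ)) : (Expr.const m q).RangeSound R τ E :=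
  ⟨hR, .const rfl rfl⟩

theorem Expr.RangeSound.neg {e : Expr} (he : e.RangeSound R τ E)
    (hR : ∃ I, R (.neg e) = some I ∧ I.Mem (-e.realValue E)) : (Expr.neg e).RangeSound R τ E :=
  ⟨he, hR, .neg rfl he.inRange.2⟩

theorem Expr.RangeSound.binop {op : BinOp} {e₁ e₂ : Expr} (h₁ : e₁.RangeSound R τ E)
    (h₂ : e₂.RangeSound R τ E) (h0 : op = .div → e₂.realValue E ≠ 0)
    (hR : ∃ I, R (.binop op e₁ e₂) = some I ∧
      I.Mem (op.eval (e₁.realValue E) (e₂.realValue E))) :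
    (Expr.binop op e₁ e₂).RangeSound R τ E :=
  ⟨h₁, h₂, hR, .binop rfl h₁.inRange.2 h₂.inRange.2 rfl h0 rfl⟩

theorem Expr.RangeSound.fma {e₁ e₂ e₃ : Expr} (h₁ : e₁.RangeSound R τ E)
    (h₂ : e₂.RangeSound R τ E) (h₃ : e₃.RangeSound R τ E)
    (hR : ∃ I, R (.fma e₁ e₂ e₃) = some I ∧
      I.Mem (e₁.realValue E * e₂.realValue E + e₃.realValue E)) :
    (Expr.fma e₁ e₂ e₃).RangeSound R τ E :=
  ⟨h₁, h₂, h₃, hR, .fma rfl h₁.inRange.2 h₂.inRange.2 h₃.inRange.2 rfl rfl⟩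

theorem Expr.RangeSound.cast {m : MType} {e : Expr} (he : e.RangeSound R τ E)
    (hR : ∃ I, R (.cast m e) = some I ∧ I.Mem (e.realValue E)) :
    (Expr.cast m e).RangeSound R τ E :=
  ⟨he, hR, .cast rfl he.inRange.2 rfl⟩

end RangeIntro

/-- The variables in `V` are bound and typed; the values of those in `dV` are in the ranges given by
`R` and the values of the others in those given by `P`. -/
def EnvInRange (P : Precond) (R : RangeMap) (τ : TypeMap) (E : Env) (V dV : Finset ℕ) : Prop :=
  ∀ x ∈ V, (τ (.var x)).isSome ∧ ∃ v, E x = some v ∧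
    if x ∈ dV then ∀ I, R (.var x) = some I → I.Mem v else (P x).Mem v

theorem EnvInRange.update {P : Precond} {R : RangeMap} {τ : TypeMap} {E : Env} {V dV : Finset ℕ}
    (h : EnvInRange P R τ E V dV) {x : ℕ} {v : ℝ} (hτ : (τ (.var x)).isSome)
    (hv : ∃ I, R (.var x) = some I ∧ I.Mem v) :
    EnvInRange P R τ (Function.update E x (some v)) (insert x V) (insert x dV) := by
  intro y hy
  by_cases hyx : y = x
  · subst hyx
    obtain ⟨I, hI, hv⟩ := hv
    refine ⟨hτ, v, by simp, ?_⟩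
    simp [hI, hv]
  · have := h y (by simpa [hyx] using hy)
    simpa [hyx] using this

/-- Every let-bound variable has the type of the bound expression and all returned expressions are
typed. -/
def Cmd.Typed (τ : TypeMap) : Cmd → Prop
  | .letin m x e s => τ e = some m ∧ τ (.var x) = some m ∧ s.Typed τ
  | .ret e => (τ e).isSome

/-! ## Interval arithmetic -/

/-- Every node is recomputed from the intervals that `R` stores for its operands, so membership in
those is all that the induction hypotheses must provide. -/
theorem Expr.rangeSound_of_checkIA {P : Precond} {R : RangeMap} {τ : TypeMap} {E : Env}
    {V dV : Finset ℕ} (hE : EnvInRange P R τ E V dV) {e : Expr} (hV : e.vars ⊆ V)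
    (h : e.checkIA P R dV = true) : e.RangeSound R τ E := by
  induction e with
  | var x =>
    obtain ⟨hτ, v, hv, hx⟩ := hE x (hV (by simp [vars]))
    refine InRange.of_var hτ hv ?_
    unfold checkIA at h
    split_ifs at h hx
    · obtain ⟨I, hI⟩ := Option.isSome_iff_exists.1 h
      exact ⟨I, hI, hx I hI⟩
    · exact RangeMap.exists_of_encloses h hx
  | const m q => exact .const (RangeMap.exists_of_encloses h (Intv.mem_point q))
  | neg e ih =>
    simp only [checkIA, Bool.and_eq_true] at h
    have he := ih hV h.1
    obtain ⟨⟨I, hI, hm⟩, -⟩ := he.inRange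
    simp only [hI] at h
    exact .neg he (RangeMap.exists_of_encloses h.2 hm.neg)
  | binop op e₁ e₂ ih₁ ih₂ =>
    simp only [vars, Finset.union_subset_iff] at hV
    simp only [checkIA, Bool.and_eq_true] at h
    have h₁ := ih₁ hV.1 h.1.1
    have h₂ := ih₂ hV.2 h.1.2
    obtain ⟨⟨I₁, hI₁, hm₁⟩, -⟩ := h₁.inRange
    obtain ⟨⟨I₂, hI₂, hm₂⟩, -⟩ := h₂.inRange
    simp only [hI₁, hI₂, Bool.and_eq_true, Bool.or_eq_true, decide_eq_true_eq] at h
    have h0 : op = .div → I₂.noZero = true := fun ho => h.2.1.resolve_left fun hn => hn ho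
    exact .binop h₁ h₂ (fun ho => hm₂.ne_zero (h0 ho))
      (RangeMap.exists_of_encloses h.2.2 (BinOp.mem_intv hm₁ hm₂ h0))
  | fma e₁ e₂ e₃ ih₁ ih₂ ih₃ =>
    simp only [vars, Finset.union_subset_iff] at hV
    simp only [checkIA, Bool.and_eq_true] at h
    have h₁ := ih₁ hV.1.1 h.1.1.1
    have h₂ := ih₂ hV.1.2 h.1.1.2
    have h₃ := ih₃ hV.2 h.1.2
    obtain ⟨⟨I₁, hI₁, hm₁⟩, -⟩ := h₁.inRange
    obtain ⟨⟨I₂, hI₂, hm₂⟩, -⟩ := h₂.inRange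
    obtain ⟨⟨I₃, hI₃, hm₃⟩, -⟩ := h₃.inRange
    simp only [hI₁, hI₂, hI₃] at h
    exact .fma h₁ h₂ h₃ (RangeMap.exists_of_encloses h.2 ((hm₁.mul hm₂).add hm₃))
  | cast m e ih =>
    simp only [checkIA, Bool.and_eq_true] at h
    have he := ih hV h.1
    obtain ⟨⟨I, hI, hm⟩, -⟩ := he.inRange
    simp only [hI] at h
    exact .cast he (RangeMap.exists_of_encloses h.2 hm)

theorem Cmd.rangeSound_of_checkIA {P : Precond} {R : RangeMap} {τ : TypeMap} {f : Cmd} {E : Env}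
    {V dV : Finset ℕ} (hE : EnvInRange P R τ E V dV) (hV : f.isSSA V = true) (hτ : f.Typed τ)
    (h : f.checkIA P R dV = true) : f.RangeSound R τ E := by
  induction f generalizing E V dV with
  | letin m x e s ih =>
    simp only [isSSA, checkIA, Bool.and_eq_true, decide_eq_true_eq] at hV h
    have he := Expr.rangeSound_of_checkIA hE hV.1.2 h.1.1
    obtain ⟨⟨I, hI, hm⟩, -⟩ := he.inRange
    simp only [hI] at h
    exact ⟨he, ih (hE.update (by simp [hτ.2.1]) (RangeMap.exists_of_encloses h.1.2 hm))
      hV.2 hτ.2.2 h.2⟩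
  | ret e =>
    simp only [isSSA, decide_eq_true_eq] at hV
    exact Expr.rangeSound_of_checkIA hE hV h

/-! ## Affine arithmetic -/

namespace AffForm

/-- Value of the linear part with coefficients `l` for the values `ε` of the noise symbols. -/
def noiseVal : List ℚ → (ℕ → ℝ) → ℝ
  | [], _ => 0
  | a :: as, ε => a * ε 0 + noiseVal as fun i => ε (i + 1)

/-- Value of an affine form for the values `ε` of the noise symbols. -/
def val (a : AffForm) (ε : ℕ → ℝ) : ℝ := a.center + noiseVal a.noise ε

theorem noiseVal_congr {l : List ℚ} {ε ε' : ℕ → ℝ} (h : ∀ i < l.length, ε i = ε' i) :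
    noiseVal l ε = noiseVal l ε' := by
  induction l generalizing ε ε' with
  | nil => rfl
  | cons a l ih =>
    simp only [List.length_cons] at h
    simp only [noiseVal, h 0 (by omega)]
    rw [ih fun i hi => h (i + 1) (by omega)]

/-- A form using only symbols below `n` does not see symbol `n`; this is what freshness means here.
-/
theorem val_update {a : AffForm} {n : ℕ} (h : a.noise.length ≤ n) (ε : ℕ → ℝ) (s : ℝ) :
    a.val (Function.update ε n s) = a.val ε := by
  unfold val
  rw [noiseVal_congr fun i hi => Function.update_of_ne (by omega) _ _]

theorem noiseVal_addNoise (l l' : List ℚ) (ε : ℕ → ℝ) :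
    noiseVal (addNoise l l') ε = noiseVal l ε + noiseVal l' ε := by
  induction l generalizing l' ε with
  | nil => simp [addNoise, noiseVal]
  | cons a l ih =>
    cases l' with
    | nil => simp [addNoise, noiseVal]
    | cons b l' =>
      simp only [addNoise, noiseVal, ih]
      push_cast
      ring

theorem length_addNoise (l l' : List ℚ) :
    (addNoise l l').length = max l.length l'.length := by
  induction l generalizing l' with
  | nil => simp [addNoise]
  | cons a l ih => cases l' <;> simp [addNoise, ih]

theorem noiseVal_map_mul (q : ℚ) (l : List ℚ) (ε : ℕ → ℝ) :
    noiseVal (l.map (q * ·)) ε = q * noiseVal l ε := by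
  induction l generalizing ε with
  | nil => simp [noiseVal]
  | cons a l ih =>
    simp only [List.map_cons, noiseVal, ih]
    push_cast
    ring

theorem noiseVal_symbol (n : ℕ) (r : ℚ) (ε : ℕ → ℝ) :
    noiseVal (List.replicate n 0 ++ [r]) ε = r * ε n := by
  induction n generalizing ε with
  | zero => simp [noiseVal]
  | succ n ih => simp [List.replicate_succ, noiseVal, ih]

@[simp] theorem val_const (q : ℚ) (ε : ℕ → ℝ) : (const q).val ε = q := by
  simp [val, const, noiseVal]

@[simp] theorem val_symbol (n : ℕ) (r : ℚ) (ε : ℕ → ℝ) : (symbol n r).val ε = r * ε n := by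
  simp [val, symbol, noiseVal_symbol]

@[simp] theorem val_add (a b : AffForm) (ε : ℕ → ℝ) : (a.add b).val ε = a.val ε + b.val ε := by
  simp only [val, add, noiseVal_addNoise]
  push_cast
  ring

@[simp] theorem val_scale (q : ℚ) (a : AffForm) (ε : ℕ → ℝ) :
    (a.scale q).val ε = q * a.val ε := by
  simp only [val, scale, noiseVal_map_mul]
  push_cast
  ring

@[simp] theorem val_neg (a : AffForm) (ε : ℕ → ℝ) : a.neg.val ε = -a.val ε := by
  simp [neg]

@[simp] theorem length_const (q : ℚ) : (const q).noise.length = 0 := rfl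

@[simp] theorem length_symbol (n : ℕ) (r : ℚ) : (symbol n r).noise.length = n + 1 := by
  simp [symbol]

@[simp] theorem length_add (a b : AffForm) :
    (a.add b).noise.length = max a.noise.length b.noise.length := length_addNoise _ _

@[simp] theorem length_scale (q : ℚ) (a : AffForm) :
    (a.scale q).noise.length = a.noise.length := by
  simp [scale]

@[simp] theorem length_neg (a : AffForm) : a.neg.noise.length = a.noise.length := length_scale _ _

theorem abs_noiseVal_le {l : List ℚ} {ε : ℕ → ℝ} (h : ∀ i, |ε i| ≤ 1) :
    |noiseVal l ε| ≤ ((l.map (|·|)).sum : ℚ) := by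
  induction l generalizing ε with
  | nil => simp [noiseVal]
  | cons a l ih =>
    simp only [noiseVal, List.map_cons, List.sum_cons, Rat.cast_add, Rat.cast_abs]
    refine (abs_add_le _ _).trans (add_le_add ?_ (ih fun i => h (i + 1)))
    rw [abs_mul]
    exact mul_le_of_le_one_right (abs_nonneg _) (h 0)

theorem mem_toIntv (a : AffForm) {ε : ℕ → ℝ} (h : ∀ i, |ε i| ≤ 1) : a.toIntv.Mem (a.val ε) := by
  have := abs_le.1 (abs_noiseVal_le (l := a.noise) h)
  constructor <;> simp only [toIntv, radius, val] <;> push_cast at this ⊢ <;> linarith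

/-- Take `s = t / r`; if `r = 0` then `t = 0` and `s = 0` serves. -/
theorem exists_noise {r t : ℝ} (h : |t| ≤ r) : ∃ s : ℝ, |s| ≤ 1 ∧ r * s = t := by
  rcases ((abs_nonneg t).trans h).eq_or_lt with h0 | h0
  · subst h0
    exact ⟨0, by simp, by simpa [eq_comm] using h⟩
  · refine ⟨t / r, ?_, by field_simp⟩
    rwa [abs_div, abs_of_pos h0, div_le_one h0]

theorem exists_noise_midpoint {l h v : ℝ} (h1 : l ≤ v) (h2 : v ≤ h) :
    ∃ s : ℝ, |s| ≤ 1 ∧ (l + h) / 2 + (h - l) / 2 * s = v := by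
  obtain ⟨s, hs, hv⟩ := exists_noise (r := (h - l) / 2) (t := v - (l + h) / 2)
    (abs_le.2 ⟨by linarith, by linarith⟩)
  exact ⟨s, hs, by rw [hv]; ring⟩

theorem exists_ofIntv {I : Intv} {v : ℝ} (h : I.Mem v) (n : ℕ) (ε : ℕ → ℝ) :
    ∃ s : ℝ, |s| ≤ 1 ∧ (ofIntv I n).val (Function.update ε n s) = v := by
  obtain ⟨s, hs, hv⟩ := exists_noise_midpoint h.1 h.2
  refine ⟨s, hs, ?_⟩
  simp only [ofIntv, val_add, val_const, val_symbol, Function.update_self]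
  push_cast
  exact hv

theorem length_ofIntv (I : Intv) (n : ℕ) : (ofIntv I n).noise.length = n + 1 := by
  simp [ofIntv]

/-- Expanding the product leaves one nonlinear term, the product of the two noise parts. It is at
most the product of the radii, so a value of the fresh symbol represents it exactly. -/
theorem exists_mul {a b : AffForm} {n : ℕ} (ha : a.noise.length ≤ n) (hb : b.noise.length ≤ n)
    {ε : ℕ → ℝ} (hε : ∀ i, |ε i| ≤ 1) :
    ∃ s : ℝ, |s| ≤ 1 ∧ (a.mul b n).val (Function.update ε n s) = a.val ε * b.val ε := by
  have hr : |noiseVal a.noise ε * noiseVal b.noise ε| ≤ (a.radius : ℝ) * (b.radius : ℝ) := by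
    rw [abs_mul]
    exact mul_le_mul (abs_noiseVal_le hε) (abs_noiseVal_le hε) (abs_nonneg _)
      ((abs_nonneg _).trans (abs_noiseVal_le hε))
  obtain ⟨s, hs, h⟩ := exists_noise hr
  refine ⟨s, hs, ?_⟩
  have ha' : (AffForm.mk 0 a.noise).val (Function.update ε n s) = noiseVal a.noise ε := by
    rw [val_update (by exact ha)]; simp [val]
  have hb' : (AffForm.mk 0 b.noise).val (Function.update ε n s) = noiseVal b.noise ε := by
    rw [val_update (by exact hb)]; simp [val]
  simp only [mul, val_add, val_const, val_scale, val_symbol, ha', hb', Function.update_self]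
  push_cast
  rw [h]
  simp only [val]
  ring

theorem length_mul {a b : AffForm} {n : ℕ} (ha : a.noise.length ≤ n) (hb : b.noise.length ≤ n) :
    (a.mul b n).noise.length ≤ n + 1 := by
  simp only [mul, length_add, length_const, length_scale, length_symbol]
  omega

/-- The drop in the inverse is `(y - x) / (x * y)`, the gain in the linear term `(y - x) / h ^ 2`,
and `x * y ≤ h ^ 2`. -/
theorem inv_add_div_sq_antitone {x y h : ℝ} (hx : 0 < x) (hxy : x ≤ y) (hy : y ≤ h) :
    y⁻¹ + y / h ^ 2 ≤ x⁻¹ + x / h ^ 2 := by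
  have hy0 := hx.trans_le hxy
  have hh := hy0.trans_le hy
  have h1 : x⁻¹ - y⁻¹ = (y - x) * (x * y)⁻¹ := by field_simp
  have h2 : y / h ^ 2 - x / h ^ 2 = (y - x) * (h ^ 2)⁻¹ := by field_simp
  have h3 : (h ^ 2)⁻¹ ≤ (x * y)⁻¹ := by
    apply inv_anti₀ (by positivity)
    rw [sq]
    exact mul_le_mul (hxy.trans hy) hy hy0.le hh.le
  have := mul_le_mul_of_nonneg_left h3 (sub_nonneg.2 hxy)
  linarith

/-- By antitonicity, `1 / x + x / h ^ 2` on `[l, h]` lies between its values at `h` and at `l`. The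
fresh symbol selects the actual value, and the linear term is subtracted again. -/
theorem exists_invPos {a : AffForm} {n : ℕ} (ha : a.noise.length ≤ n) {ε : ℕ → ℝ}
    (hε : ∀ i, |ε i| ≤ 1) (h0 : 0 < a.toIntv.lo) :
    ∃ s : ℝ, |s| ≤ 1 ∧ (a.invPos n).val (Function.update ε n s) = (a.val ε)⁻¹ := by
  obtain ⟨hl, hh⟩ := a.mem_toIntv hε
  have h0' : (0 : ℝ) < (a.toIntv.lo : ℝ) := by exact_mod_cast h0
  have h1 := inv_add_div_sq_antitone h0' hl hh
  have h2 := inv_add_div_sq_antitone (h0'.trans_le hl) hh le_rfl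
  have h3 : (a.toIntv.hi : ℝ)⁻¹ + (a.toIntv.hi : ℝ) / (a.toIntv.hi : ℝ) ^ 2
      = 2 / (a.toIntv.hi : ℝ) := by
    have := (h0'.trans_le (hl.trans hh)).ne'
    field_simp
    norm_num
  rw [h3] at h2
  obtain ⟨s, hs, hv⟩ := exists_noise_midpoint h2 h1
  refine ⟨s, hs, ?_⟩
  simp only [invPos, val_add, val_const, val_scale, val_symbol, Function.update_self,
    val_update ha]
  push_cast
  rw [← one_div] at hv
  linear_combination hv

theorem length_invPos {a : AffForm} {n : ℕ} (ha : a.noise.length ≤ n) :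
    (a.invPos n).noise.length ≤ n + 1 := by
  simp only [invPos, length_add, length_const, length_scale, length_symbol]
  omega

theorem toIntv_neg (a : AffForm) : a.neg.toIntv = a.toIntv.neg := by
  have : a.neg.radius = a.radius := by
    simp [radius, neg, scale, Function.comp_def]
  simp only [toIntv, this, Intv.neg, Intv.mk.injEq]
  simp only [neg, scale]
  constructor <;> ring

theorem exists_inv {a : AffForm} {n : ℕ} (ha : a.noise.length ≤ n) {ε : ℕ → ℝ}
    (hε : ∀ i, |ε i| ≤ 1) (h0 : a.toIntv.noZero = true) :
    ∃ s : ℝ, |s| ≤ 1 ∧ (a.inv n).val (Function.update ε n s) = (a.val ε)⁻¹ := by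
  unfold inv
  split_ifs with hlo
  · exact exists_invPos ha hε hlo
  · have hhi : a.toIntv.hi < 0 := by
      rcases Intv.noZero_iff.1 h0 with h | h
      · exact_mod_cast h
      · exact absurd (by exact_mod_cast h) hlo
    obtain ⟨s, hs, h⟩ := exists_invPos (a := a.neg) (n := n) (by simpa using ha) hε
      (by rw [toIntv_neg]; simpa [Intv.neg] using hhi)
    exact ⟨s, hs, by rw [val_neg, h, val_neg, inv_neg, neg_neg]⟩

theorem length_inv {a : AffForm} {n : ℕ} (ha : a.noise.length ≤ n) :
    (a.inv n).noise.length ≤ n + 1 := by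
  unfold inv
  split_ifs
  · exact length_invPos ha
  · simpa using length_invPos (a := a.neg) (by simpa using ha)

end AffForm

/-! ### Extending noise valuations, and soundness of the affine range check. -/

theorem abs_update_le {ε : ℕ → ℝ} (hε : ∀ i, |ε i| ≤ 1) (n : ℕ) {s : ℝ} (hs : |s| ≤ 1) (i : ℕ) :
    |Function.update ε n s i| ≤ 1 := by
  by_cases h : i = n
  · subst h; simpa using hs
  · simpa [h] using hε i

/-- Noise values `ε'` that agree with `ε` on the first `n` symbols. -/
def NoiseExtends (n : ℕ) (ε ε' : ℕ → ℝ) : Prop := (∀ i, |ε' i| ≤ 1) ∧ ∀ i < n, ε' i = ε i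

theorem NoiseExtends.refl {ε : ℕ → ℝ} (hε : ∀ i, |ε i| ≤ 1) (n : ℕ) : NoiseExtends n ε ε :=
  ⟨hε, fun _ _ => rfl⟩

theorem NoiseExtends.update {n k : ℕ} {ε ε' : ℕ → ℝ} (h : NoiseExtends n ε ε') (hk : n ≤ k)
    {s : ℝ} (hs : |s| ≤ 1) : NoiseExtends n ε (Function.update ε' k s) :=
  ⟨abs_update_le h.1 k hs, fun i hi => by
    rw [Function.update_of_ne (by omega), h.2 i hi]⟩

theorem NoiseExtends.val_eq {n : ℕ} {ε ε' : ℕ → ℝ} (h : NoiseExtends n ε ε') {a : AffForm}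
    (ha : a.noise.length ≤ n) : a.val ε' = a.val ε := by
  unfold AffForm.val
  rw [AffForm.noiseVal_congr fun i hi => h.2 i (hi.trans_le ha)]

theorem BinOp.exists_aff {op : BinOp} {a b : AffForm} {n : ℕ} (ha : a.noise.length ≤ n)
    (hb : b.noise.length ≤ n) {ε : ℕ → ℝ} (hε : ∀ i, |ε i| ≤ 1)
    (h0 : op = .div → b.toIntv.noZero = true) :
    ∃ ε', NoiseExtends n ε ε' ∧ (op.aff a b n).val ε' = op.eval (a.val ε) (b.val ε) := by
  have hrefl := NoiseExtends.refl hε n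
  cases op with
  | add => exact ⟨ε, hrefl, by simp [aff, eval]⟩
  | sub => exact ⟨ε, hrefl, by simp [aff, eval, sub_eq_add_neg]⟩
  | mul =>
    obtain ⟨s, hs, h⟩ := AffForm.exists_mul ha hb hε
    exact ⟨_, hrefl.update le_rfl hs, h⟩
  | div =>
    obtain ⟨s, hs, h⟩ := AffForm.exists_inv hb hε (h0 rfl)
    have hext := hrefl.update le_rfl hs
    -- The inverse has already used symbol `n`, so the product takes `n + 1`.
    obtain ⟨t, ht, h'⟩ := AffForm.exists_mul (a := a) (b := b.inv n) (n := n + 1) (by omega)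
      (AffForm.length_inv hb) hext.1
    refine ⟨_, hext.update (Nat.le_succ n) ht, ?_⟩
    simp only [aff, eval, h', h, AffForm.val_update ha, div_eq_mul_inv]

theorem BinOp.length_aff (op : BinOp) {a b : AffForm} {n : ℕ} (ha : a.noise.length ≤ n)
    (hb : b.noise.length ≤ n) : (op.aff a b n).noise.length ≤ n + 2 := by
  cases op with
  | add => simp only [aff, AffForm.length_add]; omega
  | sub => simp only [aff, AffForm.length_add, AffForm.length_neg]; omega
  | mul => exact (AffForm.length_mul ha hb).trans (by omega)
  | div => exact AffForm.length_mul (by omega) (AffForm.length_inv hb)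

/-- The affine forms in `st` represent, for the noise values `ε`, the real values of expressions over
`V` that are in range. -/
def AffState.Sound (R : RangeMap) (τ : TypeMap) (E : Env) (V : Finset ℕ) (st : AffState)
    (ε : ℕ → ℝ) : Prop :=
  (∀ i, |ε i| ≤ 1) ∧ ∀ e a, st.form e = some a →
    a.noise.length ≤ st.next ∧ a.val ε = e.realValue E ∧ e.RangeSound R τ E ∧ e.vars ⊆ V

section AffSound

variable {P : Precond} {R : RangeMap} {τ : TypeMap} {E : Env} {V dV : Finset ℕ}

theorem AffState.Sound.update {st : AffState} {ε ε' : ℕ → ℝ} (h : st.Sound R τ E V ε)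
    (hε : NoiseExtends st.next ε ε') {n : ℕ} (hn : st.next ≤ n) {e : Expr} {a : AffForm}
    (hlen : a.noise.length ≤ n) (hval : a.val ε' = e.realValue E) (he : e.RangeSound R τ E)
    (hV : e.vars ⊆ V) :
    AffState.Sound R τ E V ⟨Function.update st.form e (some a), n⟩ ε' := by
  refine ⟨hε.1, fun e' a' h' => ?_⟩
  by_cases hee : e' = e
  · subst hee
    simp only [Function.update_self, Option.some.injEq] at h'
    subst h'
    exact ⟨hlen, hval, he, hV⟩
  · simp only [Function.update_of_ne hee] at h'
    obtain ⟨h1, h2, h3⟩ := h.2 e' a' h'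
    exact ⟨h1.trans hn, by rw [hε.val_eq h1, h2], h3⟩

/-- `he` is an implication because membership in `R e` becomes available only from the enclosure
test made on recording. -/
theorem AffState.Sound.record {st st' : AffState} {ε ε' : ℕ → ℝ} (h : st.Sound R τ E V ε)
    (hε : NoiseExtends st.next ε ε') {n : ℕ} (hn : st.next ≤ n) {e : Expr} {a : AffForm}
    (hrec : AffState.record R e a st.form n = some st')
    (hlen : a.noise.length ≤ n) (hval : a.val ε' = e.realValue E)
    (he : (∃ I, R e = some I ∧ I.Mem (e.realValue E)) → e.RangeSound R τ E) (hV : e.vars ⊆ V) :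
    st'.Sound R τ E V ε' ∧ (st'.form e).isSome := by
  unfold AffState.record at hrec
  split_ifs at hrec with henc
  simp only [Option.some.injEq] at hrec
  subst hrec
  refine ⟨h.update hε hn hlen hval (he ?_) hV, by simp⟩
  rw [← hval]
  exact RangeMap.exists_of_encloses henc (a.mem_toIntv hε.1)

/-- On a cache hit nothing is rechecked, which is why `AffState.Sound` carries range soundness of
every recorded expression; it is retrieved from there for operands and results alike. -/
theorem Expr.sound_of_checkAA (hE : EnvInRange P R τ E V dV) {e : Expr} (hV : e.vars ⊆ V)
    {st st' : AffState} {ε : ℕ → ℝ} (hst : st.Sound R τ E V ε)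
    (h : e.checkAA P R dV st = some st') :
    ∃ ε', st'.Sound R τ E V ε' ∧ (st'.form e).isSome := by
  induction e generalizing st st' ε with
  | var x =>
    unfold checkAA at h
    split_ifs at h with hc hx
    · cases h; exact ⟨ε, hst, hc⟩
    · obtain ⟨hτ, v, hv, hm⟩ := hE x (hV (by simp [vars]))
      rw [if_pos hx] at hm
      simp only [Option.bind_eq_some_iff] at h
      obtain ⟨I, hI, h⟩ := h
      simp only [Option.some.injEq] at h
      subst h
      obtain ⟨s, hs, hval⟩ := AffForm.exists_ofIntv (hm I hI) st.next ε
      -- The form is built from `R` itself, so no enclosure test is involved.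
      refine ⟨_, hst.update ((NoiseExtends.refl hst.1 _).update le_rfl hs) (Nat.le_succ _)
        (AffForm.length_ofIntv _ _).le (by simp [hval, realValue, hv])
        (InRange.of_var hτ hv ⟨I, hI, hm I hI⟩) hV, by simp⟩
    · obtain ⟨hτ, v, hv, hm⟩ := hE x (hV (by simp [vars]))
      rw [if_neg hx] at hm
      obtain ⟨s, hs, hval⟩ := AffForm.exists_ofIntv hm st.next ε
      exact ⟨_, hst.record ((NoiseExtends.refl hst.1 _).update le_rfl hs) (Nat.le_succ _) h
        (AffForm.length_ofIntv _ _).le (by simp [hval, realValue, hv])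
        (fun hR => InRange.of_var hτ hv (by simpa [realValue, hv] using hR)) hV⟩
  | const m q =>
    unfold checkAA at h
    split_ifs at h with hc
    · cases h; exact ⟨ε, hst, hc⟩
    · exact ⟨ε, hst.record (NoiseExtends.refl hst.1 _) le_rfl h (by simp)
        (by simp [realValue]) (fun hR => .const hR) hV⟩
  | neg e ih =>
    unfold checkAA at h
    split_ifs at h with hc
    · cases h; exact ⟨ε, hst, hc⟩
    simp only [Option.bind_eq_some_iff] at h
    obtain ⟨st₁, h₁, a, ha, h⟩ := h
    obtain ⟨ε₁, hs₁, -⟩ := ih hV hst h₁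
    obtain ⟨hl, hv, hr, -⟩ := hs₁.2 _ _ ha
    exact ⟨ε₁, hs₁.record (NoiseExtends.refl hs₁.1 _) le_rfl h (by simpa using hl)
      (by simp [hv, realValue]) (fun hR => .neg hr hR) hV⟩
  | binop op e₁ e₂ ih₁ ih₂ =>
    unfold checkAA at h
    split_ifs at h with hc
    · cases h; exact ⟨ε, hst, hc⟩
    have hV' := Finset.union_subset_iff.1 hV
    simp only [Option.bind_eq_some_iff] at h
    obtain ⟨st₁, h₁, st₂, h₂, a₁, ha₁, a₂, ha₂, h⟩ := h
    obtain ⟨ε₁, hs₁, -⟩ := ih₁ hV'.1 hst h₁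
    obtain ⟨ε₂, hs₂, -⟩ := ih₂ hV'.2 hs₁ h₂
    obtain ⟨hl₁, hv₁, hr₁, -⟩ := hs₂.2 _ _ ha₁
    obtain ⟨hl₂, hv₂, hr₂, -⟩ := hs₂.2 _ _ ha₂
    split_ifs at h with hz
    simp only [Bool.or_eq_true, decide_eq_true_eq] at hz
    have h0 : op = .div → a₂.toIntv.noZero = true := fun ho => hz.resolve_left fun hn => hn ho
    obtain ⟨ε₃, hext, hval⟩ := BinOp.exists_aff hl₁ hl₂ hs₂.1 h0
    refine ⟨ε₃, hs₂.record hext (by omega) h (op.length_aff hl₁ hl₂)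
      (by rw [hval, hv₁, hv₂, realValue]) (fun hR => .binop hr₁ hr₂ (fun ho => ?_) hR) hV⟩
    rw [← hv₂]
    exact (a₂.mem_toIntv hs₂.1).ne_zero (h0 ho)
  | fma e₁ e₂ e₃ ih₁ ih₂ ih₃ =>
    unfold checkAA at h
    split_ifs at h with hc
    · cases h; exact ⟨ε, hst, hc⟩
    have hV' := Finset.union_subset_iff.1 hV
    have hV'' := Finset.union_subset_iff.1 hV'.1
    simp only [Option.bind_eq_some_iff] at h
    obtain ⟨st₁, h₁, st₂, h₂, st₃, h₃, a₁, ha₁, a₂, ha₂, a₃, ha₃, h⟩ := h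
    obtain ⟨ε₁, hs₁, -⟩ := ih₁ hV''.1 hst h₁
    obtain ⟨ε₂, hs₂, -⟩ := ih₂ hV''.2 hs₁ h₂
    obtain ⟨ε₃, hs₃, -⟩ := ih₃ hV'.2 hs₂ h₃
    obtain ⟨hl₁, hv₁, hr₁, -⟩ := hs₃.2 _ _ ha₁
    obtain ⟨hl₂, hv₂, hr₂, -⟩ := hs₃.2 _ _ ha₂
    obtain ⟨hl₃, hv₃, hr₃, -⟩ := hs₃.2 _ _ ha₃
    obtain ⟨s, hs, hval⟩ := AffForm.exists_mul hl₁ hl₂ hs₃.1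
    refine ⟨_, hs₃.record ((NoiseExtends.refl hs₃.1 _).update le_rfl hs) (Nat.le_succ _) h ?_ ?_
      (fun hR => .fma hr₁ hr₂ hr₃ hR) hV⟩
    · have := AffForm.length_mul hl₁ hl₂
      simp only [AffForm.length_add]
      omega
    · rw [AffForm.val_add, hval, AffForm.val_update hl₃, hv₁, hv₂, hv₃, realValue]
  | cast m e ih =>
    unfold checkAA at h
    split_ifs at h with hc
    · cases h; exact ⟨ε, hst, hc⟩
    simp only [Option.bind_eq_some_iff] at h
    obtain ⟨st₁, h₁, a, ha, h⟩ := h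
    obtain ⟨ε₁, hs₁, -⟩ := ih hV hst h₁
    obtain ⟨hl, hv, hr, -⟩ := hs₁.2 _ _ ha
    exact ⟨ε₁, hs₁.record (NoiseExtends.refl hs₁.1 _) le_rfl h hl
      (by simp [hv, realValue]) (fun hR => .cast hr hR) hV⟩

/-- Recorded expressions mention only `V`, so by SSA none of them contains the new variable. -/
theorem AffState.Sound.env_update {st : AffState} {ε : ℕ → ℝ} (h : st.Sound R τ E V ε) {x : ℕ}
    (hx : x ∉ V) (v : ℝ) :
    st.Sound R τ (Function.update E x (some v)) (insert x V) ε := by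
  refine ⟨h.1, fun e a ha => ?_⟩
  obtain ⟨h1, h2, h3, h4⟩ := h.2 e a ha
  have hagree : ∀ y ∈ e.vars, E y = Function.update E x (some v) y := fun y hy => by
    rw [Function.update_of_ne]
    rintro rfl
    exact hx (h4 hy)
  exact ⟨h1, by rw [h2, Expr.realValue_congr hagree], h3.congr hagree,
    h4.trans (Finset.subset_insert _ _)⟩

theorem Cmd.rangeSound_of_checkAA {f : Cmd} (hE : EnvInRange P R τ E V dV)
    (hV : f.isSSA V = true) (hτ : f.Typed τ) {st : AffState} {ε : ℕ → ℝ}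
    (hst : st.Sound R τ E V ε) (h : (f.checkAA P R dV st).isSome) : f.RangeSound R τ E := by
  induction f generalizing E V dV st ε with
  | letin m x e s ih =>
    simp only [isSSA, Bool.and_eq_true, decide_eq_true_eq] at hV
    obtain ⟨st', h⟩ := Option.isSome_iff_exists.1 h
    simp only [checkAA, Option.bind_eq_some_iff] at h
    obtain ⟨st₁, h₁, a, ha, st₂, h₂, h⟩ := h
    obtain ⟨ε₁, hs₁, -⟩ := Expr.sound_of_checkAA hE hV.1.2 hst h₁
    obtain ⟨hl, hv, hr, -⟩ := hs₁.2 _ _ ha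
    have hτx : (τ (.var x)).isSome := by simp [hτ.2.1]
    have hxv : (Expr.var x).realValue (Function.update E x (some (e.realValue E)))
        = e.realValue E := by simp [Expr.realValue]
    -- The variable shares the form of `e`, so the valuation `ε₁` is kept and correlations are
    -- preserved.
    obtain ⟨hs₂, hx⟩ := (hs₁.env_update hV.1.1 (e.realValue E)).record
      (NoiseExtends.refl hs₁.1 _) le_rfl h₂ hl (by rw [hv, hxv])
      (fun hR => InRange.of_var hτx (Function.update_self ..) (by rwa [hxv] at hR))
      (by simp [Expr.vars])
    obtain ⟨b, hb⟩ := Option.isSome_iff_exists.1 hx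
    obtain ⟨hR, -⟩ := (hs₂.2 _ _ hb).2.2.1.inRange
    rw [hxv] at hR
    exact ⟨hr, ih (hE.update hτx hR) hV.2 hτ.2.2 hs₂ (by simp [h])⟩
  | ret e =>
    simp only [isSSA, decide_eq_true_eq] at hV
    obtain ⟨st', h⟩ := Option.isSome_iff_exists.1 h
    obtain ⟨ε', hs, he⟩ := Expr.sound_of_checkAA hE hV hst h
    obtain ⟨a, ha⟩ := Option.isSome_iff_exists.1 he
    exact (hs.2 _ _ ha).2.2.1

theorem rangeSound_of_validRanges {f : Cmd} (hE : EnvInRange P R τ E V dV)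
    (hV : f.isSSA V = true) (hτ : f.Typed τ) (h : validRanges f P R dV = true) :
    f.RangeSound R τ E := by
  simp only [validRanges, Bool.or_eq_true] at h
  rcases h with h | h
  · exact Cmd.rangeSound_of_checkIA hE hV hτ h
  -- No form is recorded initially, so any valuation within [-1, 1] would do.
  · exact Cmd.rangeSound_of_checkAA (ε := 0) hE hV hτ ⟨by simp, by simp⟩ h

end AffSound

/-! ## Types -/

/-- The type `m` of an expression is consistent with the types of its operands. -/
def TypeMap.Fits (τ : TypeMap) (m : MType) : Expr → Prop
  | .var _ => True
  | .const m' _ => m = m'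
  | .neg e => τ e = some m
  | .binop _ e₁ e₂ => ∃ m₁ m₂, τ e₁ = some m₁ ∧ τ e₂ = some m₂ ∧ MType.isJoin m₁ m₂ m = true
  | .fma e₁ e₂ e₃ => ∃ m₁ m₂ m₃, τ e₁ = some m₁ ∧ τ e₂ = some m₂ ∧ τ e₃ = some m₃ ∧
      MType.isJoin₃ m₁ m₂ m₃ m = true
  | .cast m' e => m = m' ∧ ∃ m₁, τ e = some m₁

/-- The types of all typed expressions are consistent with those of their operands. -/
def TypeMap.Closed (τ : TypeMap) : Prop := ∀ e m, τ e = some m → τ.Fits m e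

/-- `τ'` types everything that `τ` types, in the same way. -/
def TypeMap.Extends (τ τ' : TypeMap) : Prop := ∀ e m, τ e = some m → τ' e = some m

theorem TypeMap.Extends.refl (τ : TypeMap) : τ.Extends τ := fun _ _ h => h

theorem TypeMap.Extends.trans {τ₁ τ₂ τ₃ : TypeMap} (h : τ₁.Extends τ₂) (h' : τ₂.Extends τ₃) :
    τ₁.Extends τ₃ := fun e m he => h' e m (h e m he)

theorem TypeMap.Fits.mono {τ τ' : TypeMap} (hext : τ.Extends τ') {m : MType} {e : Expr}
    (h : τ.Fits m e) : τ'.Fits m e := by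
  cases e with
  | var => trivial
  | const => exact h
  | neg e => exact hext _ _ h
  | binop op e₁ e₂ =>
    obtain ⟨m₁, m₂, h₁, h₂, hj⟩ := h
    exact ⟨m₁, m₂, hext _ _ h₁, hext _ _ h₂, hj⟩
  | fma e₁ e₂ e₃ =>
    obtain ⟨m₁, m₂, m₃, h₁, h₂, h₃, hj⟩ := h
    exact ⟨m₁, m₂, m₃, hext _ _ h₁, hext _ _ h₂, hext _ _ h₃, hj⟩
  | cast m'' e =>
    obtain ⟨h₁, m₁, h₂⟩ := h
    exact ⟨h₁, m₁, hext _ _ h₂⟩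

theorem eq_update_of_addType {Γ τ τ' : TypeMap} {e : Expr} {m : MType}
    (h : addType Γ e m τ = some τ') : τ' = Function.update τ e (some m) := by
  unfold addType at h
  split_ifs at h
  exact (Option.some.inj h).symm

theorem addType_extends {Γ τ τ' : TypeMap} {e : Expr} {m : MType} (h : addType Γ e m τ = some τ')
    (he : τ e = none) : τ.Extends τ' := by
  rw [eq_update_of_addType h]
  intro e' m' h'
  rw [Function.update_of_ne, h']
  rintro rfl
  simp [he] at h'

theorem addType_self {Γ τ τ' : TypeMap} {e : Expr} {m : MType} (h : addType Γ e m τ = some τ') :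
    τ' e = some m := by
  rw [eq_update_of_addType h, Function.update_self]

theorem addType_closed {Γ τ τ' : TypeMap} {e : Expr} {m : MType} (h : addType Γ e m τ = some τ')
    (he : τ e = none) (hτ : τ.Closed) (hm : τ.Fits m e) : τ'.Closed := by
  intro e' m' h'
  refine TypeMap.Fits.mono (addType_extends h he) ?_
  by_cases hee : e' = e
  · subst hee
    rw [addType_self h, Option.some.injEq] at h'
    exact h' ▸ hm
  · rw [eq_update_of_addType h, Function.update_of_ne hee] at h'
    exact hτ e' m' h'

theorem addType_of_sizeOf_lt {Γ τ τ' : TypeMap} {e e' : Expr} {m : MType}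
    (h : addType Γ e m τ = some τ') (hlt : sizeOf e < sizeOf e') : τ' e' = τ e' := by
  rw [eq_update_of_addType h, Function.update_of_ne]
  rintro rfl
  exact lt_irrefl _ hlt

/-- Type inference does not touch expressions larger than the given one. -/
theorem Expr.inferTypes_of_sizeOf_lt {Γ : TypeMap} {e : Expr} {τ τ' : TypeMap}
    (h : e.inferTypes Γ τ = some τ') {e' : Expr} (he : sizeOf e < sizeOf e') : τ' e' = τ e' := by
  induction e generalizing τ τ' with
  | var x =>
    unfold inferTypes at h
    split_ifs at h
    · cases h; rfl
    simp only [Option.bind_eq_some_iff] at h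
    obtain ⟨m, -, h⟩ := h
    exact addType_of_sizeOf_lt h he
  | const m q =>
    unfold inferTypes at h
    split_ifs at h
    · cases h; rfl
    exact addType_of_sizeOf_lt h he
  | neg e ih =>
    unfold inferTypes at h
    split_ifs at h
    · cases h; rfl
    simp only [Option.bind_eq_some_iff] at h
    obtain ⟨τ₁, h₁, m, -, h⟩ := h
    rw [addType_of_sizeOf_lt h he]
    simp only [neg.sizeOf_spec] at he
    rw [ih h₁ (by omega)]
  | binop op e₁ e₂ ih₁ ih₂ =>
    unfold inferTypes at h
    split_ifs at h
    · cases h; rfl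
    simp only [Option.bind_eq_some_iff] at h
    obtain ⟨τ₁, h₁, τ₂, h₂, m₁, -, m₂, -, m, -, h⟩ := h
    split_ifs at h
    rw [addType_of_sizeOf_lt h he]
    simp only [binop.sizeOf_spec] at he
    rw [ih₂ h₂ (by omega), ih₁ h₁ (by omega)]
  | fma e₁ e₂ e₃ ih₁ ih₂ ih₃ =>
    unfold inferTypes at h
    split_ifs at h
    · cases h; rfl
    simp only [Option.bind_eq_some_iff] at h
    obtain ⟨τ₁, h₁, τ₂, h₂, τ₃, h₃, m₁, -, m₂, -, m₃, -, m, -, h⟩ := h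
    split_ifs at h
    rw [addType_of_sizeOf_lt h he]
    simp only [fma.sizeOf_spec] at he
    rw [ih₃ h₃ (by omega), ih₂ h₂ (by omega), ih₁ h₁ (by omega)]
  | cast m e ih =>
    unfold inferTypes at h
    split_ifs at h
    · cases h; rfl
    simp only [Option.bind_eq_some_iff] at h
    obtain ⟨τ₁, h₁, h⟩ := h
    rw [addType_of_sizeOf_lt h he]
    simp only [cast.sizeOf_spec] at he
    rw [ih h₁ (by omega)]

/-- The point to secure is that recording a type never overwrites one: then consistency facts
established earlier persist. -/
theorem Expr.inferTypes_sound {Γ : TypeMap} {e : Expr} {τ τ' : TypeMap}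
    (h : e.inferTypes Γ τ = some τ') (hτ : τ.Closed) :
    τ'.Closed ∧ τ.Extends τ' ∧ (τ' e).isSome := by
  induction e generalizing τ τ' with
  | var x =>
    unfold inferTypes at h
    split_ifs at h with hc
    · cases h; exact ⟨hτ, .refl _, hc⟩
    rw [Option.not_isSome_iff_eq_none] at hc
    simp only [Option.bind_eq_some_iff] at h
    obtain ⟨m, -, h⟩ := h
    exact ⟨addType_closed h hc hτ trivial, addType_extends h hc, by simp [addType_self h]⟩
  | const m q =>
    unfold inferTypes at h
    split_ifs at h with hc
    · cases h; exact ⟨hτ, .refl _, hc⟩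
    rw [Option.not_isSome_iff_eq_none] at hc
    exact ⟨addType_closed h hc hτ rfl, addType_extends h hc, by simp [addType_self h]⟩
  | neg e ih =>
    unfold inferTypes at h
    split_ifs at h with hc
    · cases h; exact ⟨hτ, .refl _, hc⟩
    rw [Option.not_isSome_iff_eq_none] at hc
    simp only [Option.bind_eq_some_iff] at h
    obtain ⟨τ₁, h₁, m, hm, h⟩ := h
    obtain ⟨c₁, x₁, -⟩ := ih h₁ hτ
    -- Inference on the smaller operand leaves the whole expression untyped; the other compound
    -- cases argue likewise.
    rw [← inferTypes_of_sizeOf_lt h₁ (by simp)] at hc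
    exact ⟨addType_closed h hc c₁ hm, x₁.trans (addType_extends h hc), by simp [addType_self h]⟩
  | binop op e₁ e₂ ih₁ ih₂ =>
    unfold inferTypes at h
    split_ifs at h with hc
    · cases h; exact ⟨hτ, .refl _, hc⟩
    rw [Option.not_isSome_iff_eq_none] at hc
    simp only [Option.bind_eq_some_iff] at h
    obtain ⟨τ₁, h₁, τ₂, h₂, m₁, hm₁, m₂, hm₂, m, -, h⟩ := h
    split_ifs at h with hj
    obtain ⟨c₁, x₁, -⟩ := ih₁ h₁ hτ
    obtain ⟨c₂, x₂, -⟩ := ih₂ h₂ c₁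
    rw [← inferTypes_of_sizeOf_lt h₁ (by simp; omega),
      ← inferTypes_of_sizeOf_lt h₂ (by simp)] at hc
    exact ⟨addType_closed h hc c₂ ⟨m₁, m₂, hm₁, hm₂, hj⟩,
      (x₁.trans x₂).trans (addType_extends h hc), by simp [addType_self h]⟩
  | fma e₁ e₂ e₃ ih₁ ih₂ ih₃ =>
    unfold inferTypes at h
    split_ifs at h with hc
    · cases h; exact ⟨hτ, .refl _, hc⟩
    rw [Option.not_isSome_iff_eq_none] at hc
    simp only [Option.bind_eq_some_iff] at h
    obtain ⟨τ₁, h₁, τ₂, h₂, τ₃, h₃, m₁, hm₁, m₂, hm₂, m₃, hm₃, m, -, h⟩ := h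
    split_ifs at h with hj
    obtain ⟨c₁, x₁, -⟩ := ih₁ h₁ hτ
    obtain ⟨c₂, x₂, -⟩ := ih₂ h₂ c₁
    obtain ⟨c₃, x₃, -⟩ := ih₃ h₃ c₂
    rw [← inferTypes_of_sizeOf_lt h₁ (by simp; omega),
      ← inferTypes_of_sizeOf_lt h₂ (by simp; omega),
      ← inferTypes_of_sizeOf_lt h₃ (by simp)] at hc
    exact ⟨addType_closed h hc c₃ ⟨m₁, m₂, m₃, hm₁, hm₂, hm₃, hj⟩,
      ((x₁.trans x₂).trans x₃).trans (addType_extends h hc), by simp [addType_self h]⟩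
  | cast m e ih =>
    unfold inferTypes at h
    split_ifs at h with hc
    · cases h; exact ⟨hτ, .refl _, hc⟩
    rw [Option.not_isSome_iff_eq_none] at hc
    simp only [Option.bind_eq_some_iff] at h
    obtain ⟨τ₁, h₁, h⟩ := h
    obtain ⟨c₁, x₁, s₁⟩ := ih h₁ hτ
    rw [← inferTypes_of_sizeOf_lt h₁ (by simp)] at hc
    exact ⟨addType_closed h hc c₁ ⟨rfl, Option.isSome_iff_exists.1 s₁⟩,
      x₁.trans (addType_extends h hc), by simp [addType_self h]⟩

theorem Cmd.inferTypes_sound {Γ : TypeMap} {f : Cmd} {τ τ' : TypeMap}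
    (h : f.inferTypes Γ τ = some τ') (hτ : τ.Closed) :
    τ'.Closed ∧ τ.Extends τ' ∧ f.Typed τ' := by
  induction f generalizing τ τ' with
  | letin m x e s ih =>
    simp only [inferTypes, Option.bind_eq_some_iff] at h
    obtain ⟨τ₁, h₁, h⟩ := h
    split_ifs at h with hm
    simp only [Option.bind_eq_some_iff] at h
    obtain ⟨τ₂, h₂, h⟩ := h
    obtain ⟨c₁, x₁, -⟩ := Expr.inferTypes_sound h₁ hτ
    have x₂ := addType_extends h₂ hm.2
    obtain ⟨c₃, x₃, t₃⟩ := ih h (addType_closed h₂ hm.2 c₁ trivial)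
    exact ⟨c₃, (x₁.trans x₂).trans x₃, x₃ _ _ (x₂ _ _ hm.1), x₃ _ _ (addType_self h₂), t₃⟩
  | ret e => exact Expr.inferTypes_sound h hτ

theorem validTypes_sound {Γ τ : TypeMap} {f : Cmd} (h : validTypes Γ f = some τ) :
    τ.Closed ∧ f.Typed τ := by
  -- The empty initial type map is vacuously closed.
  obtain ⟨h₁, -, h₂⟩ := Cmd.inferTypes_sound h fun _ _ h => nomatch h
  exact ⟨h₁, h₂⟩

/-! ## Errors -/

theorem Expr.Eval.type_eq {E : Env} {τ : TypeMap} {e : Expr} {v : ℝ} {m : MType}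
    (h : e.Eval E τ v m) : τ e = some m := by
  cases h <;> assumption

/-- The difference is expanded around the real operands `a`, `b`, so only their ranges and the two
errors enter. -/
theorem abs_mul_sub_mul_le {a b a' b' A B ea eb : ℝ} (ha : |a| ≤ A) (hb : |b| ≤ B)
    (hea : |a - a'| ≤ ea) (heb : |b - b'| ≤ eb) :
    |a * b - a' * b'| ≤ A * eb + B * ea + ea * eb := by
  have h : a * b - a' * b' = a * (b - b') + b * (a - a') - (a - a') * (b - b') := by ring
  rw [h]
  refine (abs_sub _ _).trans (add_le_add ((abs_add_le _ _).trans (add_le_add ?_ ?_)) ?_) <;>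
    rw [abs_mul]
  · exact mul_le_mul ha heb (abs_nonneg _) ((abs_nonneg _).trans ha)
  · exact mul_le_mul hb hea (abs_nonneg _) ((abs_nonneg _).trans hb)
  · exact mul_le_mul hea heb (abs_nonneg _) ((abs_nonneg _).trans hea)

theorem abs_inv_sub_inv_le {b b' c eb : ℝ} (hc : 0 < c) (hb : c ≤ |b|) (hb' : c ≤ |b'|)
    (heb : |b - b'| ≤ eb) : |b⁻¹ - b'⁻¹| ≤ eb / c ^ 2 := by
  have h : b⁻¹ - b'⁻¹ = (b' - b) / (b * b') := by
    have := abs_pos.1 (hc.trans_le hb)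
    have := abs_pos.1 (hc.trans_le hb')
    field_simp
  rw [h, abs_div, abs_mul, abs_sub_comm]
  refine div_le_div₀ ((abs_nonneg _).trans heb) heb (by positivity) ?_
  rw [sq]
  exact mul_le_mul hb hb' hc.le (abs_nonneg _)

/-! ### Error bounds for single operations. -/

section OperationErrors

variable {m : MType} {I₁ I₂ I₃ : Intv} {err₁ err₂ err₃ : ℚ} {v₁ v₂ v₃ w₁ w₂ w₃ w : ℝ}

theorem abs_sub_le_add_errorQ {I : Intv} {u u' c : ℝ} (h : |u - u'| ≤ c) (hI : I.Mem u')
    (hr : m.Rounds u' w) : |u - w| ≤ c + (m.errorQ I.maxAbs : ℝ) :=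
  (abs_sub_le u u' w).trans (add_le_add h (MType.abs_sub_le_errorQ hr hI.abs_le))

theorem BinOp.abs_sub_le_errorBound {op : BinOp} (hI₁ : I₁.Mem v₁) (hI₂ : I₂.Mem v₂)
    (he₁ : |v₁ - w₁| ≤ (err₁ : ℝ)) (he₂ : |v₂ - w₂| ≤ (err₂ : ℝ)) (herr₂ : 0 ≤ err₂)
    (h0 : op = .div → (I₂.widen err₂).noZero = true) (hr : m.Rounds (op.eval w₁ w₂) w) :
    |op.eval v₁ v₂ - w| ≤ (op.errorBound m I₁ err₁ I₂ err₂ : ℝ) := by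
  have hw := BinOp.mem_intv (hI₁.widen he₁) (hI₂.widen he₂) h0
  cases op with
  | add =>
    simp only [errorBound]
    push_cast
    refine abs_sub_le_add_errorQ ?_ hw hr
    simp only [eval, add_sub_add_comm]
    exact (abs_add_le _ _).trans (add_le_add he₁ he₂)
  | sub =>
    simp only [errorBound]
    push_cast
    refine abs_sub_le_add_errorQ ?_ hw hr
    simp only [eval]
    rw [show v₁ - v₂ - (w₁ - w₂) = v₁ - w₁ - (v₂ - w₂) by ring]
    exact (abs_sub _ _).trans (add_le_add he₁ he₂)
  | mul =>
    simp only [errorBound]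
    push_cast
    exact abs_sub_le_add_errorQ (abs_mul_sub_mul_le hI₁.abs_le hI₂.abs_le he₁ he₂) hw hr
  | div =>
    have h0 := h0 rfl
    simp only [errorBound]
    push_cast
    refine abs_sub_le_add_errorQ ?_ hw hr
    simp only [eval, div_eq_mul_inv v₁, div_eq_mul_inv w₁]
    -- Both the real and the machine divisor lie in the widened range, so its `minAbs` bounds both
    -- away from zero. Division is then treated as multiplication by the inverse.
    have hv := hI₂.widen_self herr₂
    exact abs_mul_sub_mul_le hI₁.abs_le
      (hI₂.inv (Intv.noZero_of_widen herr₂ h0)).abs_le he₁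
      (abs_inv_sub_inv_le (hv.minAbs_pos h0) (hv.minAbs_le h0) ((hI₂.widen he₂).minAbs_le h0) he₂)

theorem abs_sub_le_fmaErrorBound (hI₁ : I₁.Mem v₁) (hI₂ : I₂.Mem v₂) (hI₃ : I₃.Mem v₃)
    (he₁ : |v₁ - w₁| ≤ (err₁ : ℝ)) (he₂ : |v₂ - w₂| ≤ (err₂ : ℝ)) (he₃ : |v₃ - w₃| ≤ (err₃ : ℝ))
    (hr : m.Rounds (w₁ * w₂ + w₃) w) :
    |v₁ * v₂ + v₃ - w| ≤ (fmaErrorBound m I₁ err₁ I₂ err₂ I₃ err₃ : ℝ) := by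
  simp only [fmaErrorBound]
  push_cast
  refine abs_sub_le_add_errorQ ?_
    (((hI₁.widen he₁).mul (hI₂.widen he₂)).add (hI₃.widen he₃)) hr
  rw [add_sub_add_comm]
  exact (abs_add_le _ _).trans
    (add_le_add (abs_mul_sub_mul_le hI₁.abs_le hI₂.abs_le he₁ he₂) he₃)

end OperationErrors

/-- The variables in `V` are bound in both environments and typed; the values of those in `dV` differ
by at most their error bound, those of the others by at most one rounding error. -/
def EnvClose (Err : ErrorMap) (τ : TypeMap) (E E' : Env) (V dV : Finset ℕ) : Prop :=
  ∀ x ∈ V, ∃ v v' m, E x = some v ∧ E' x = some v' ∧ τ (.var x) = some m ∧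
    if x ∈ dV then ∃ err, Err (.var x) = some err ∧ |v - v'| ≤ (err : ℝ) else |v - v'| ≤ m.error v

/-! ### Soundness of the error validator. -/

section ErrorSound

variable {R : RangeMap} {Err : ErrorMap} {τ : TypeMap} {E E' : Env} {V dV : Finset ℕ}

theorem EnvClose.update (h : EnvClose Err τ E E' V dV) {x : ℕ} {m : MType} {v v' : ℝ} {err : ℚ}
    (hτ : τ (.var x) = some m) (herr : Err (.var x) = some err) (hv : |v - v'| ≤ (err : ℝ)) :
    EnvClose Err τ (Function.update E x (some v)) (Function.update E' x (some v')) (insert x V)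
      (insert x dV) := by
  intro y hy
  by_cases hyx : y = x
  · subst hyx
    exact ⟨v, v', m, by simp, by simp, hτ, by simp [herr, hv]⟩
  · simpa [hyx] using h y (by simpa [hyx] using hy)

/-- Replaces the inductive relation by a pointwise one, independent of the order in which variables
were added. -/
theorem ApproxEnv.envClose (h : ApproxEnv Err τ E V dV E') :
    EnvClose Err τ E E' (V ∪ dV) dV := by
  induction h with
  | empty => simp [EnvClose]
  | @freeVar E E' fV dV x m v v' _ hx hτ hv ih =>
    have hx' : x ∉ dV := fun h => hx (Finset.mem_union_right _ h)
    intro y hy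
    by_cases hyx : y = x
    · subst hyx
      exact ⟨v, v', m, by simp, by simp, hτ, by simpa [hx'] using hv⟩
    · simpa [hyx] using ih y (by simpa [hyx] using hy)
  | @definedVar E E' fV dV x m err v v' _ _ hτ herr hv ih =>
    rw [Finset.union_insert]
    exact ih.update hτ herr hv

/-- The finite-precision execution of `e` succeeds, and its results deviate from the real value by at
most the error bound given by `Err`. -/
def ErrorSound (Err : ErrorMap) (τ : TypeMap) (E E' : Env) (e : Expr) : Prop :=
  ∃ err, Err e = some err ∧ 0 ≤ err ∧ (∃ v m, e.Eval E' τ v m) ∧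
    ∀ v m, e.Eval E' τ v m → |e.realValue E - v| ≤ (err : ℝ)

theorem Expr.errorSound_of_checkError (hE : EnvClose Err τ E E' V dV) (hτ : τ.Closed) {e : Expr}
    (hV : e.vars ⊆ V) (hty : (τ e).isSome) (hR : e.RangeSound R τ E)
    (h : e.checkError τ R Err dV = true) : ErrorSound Err τ E E' e := by
  induction e with
  | var x =>
    obtain ⟨v, v', m, hv, hv', hm, hx⟩ := hE x (hV (by simp [vars]))
    obtain ⟨⟨I, hI, hmem⟩, -⟩ := hR.inRange
    simp only [realValue, hv, Option.getD_some] at hmem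
    cases herr : Err (.var x) with
    | none => simp [checkError, hm, hI, herr] at h
    | some err =>
    simp only [checkError, hm, hI, herr, Bool.and_eq_true, Bool.or_eq_true,
      decide_eq_true_eq] at h
    refine ⟨err, herr, h.1, ⟨v', m, .var hm hv'⟩, fun w m' hw => ?_⟩
    cases hw with
    | var _ hw =>
    rw [hv', Option.some.injEq] at hw
    subst hw
    simp only [realValue, hv, Option.getD_some]
    split_ifs at hx with hxd
    · obtain ⟨err', herr', hx⟩ := hx
      rw [herr, Option.some.injEq] at herr'
      exact herr' ▸ hx
    -- The rounding error of an input is relative to its real value, so the unwidened range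
    -- suffices.
    · refine (hx.trans (m.error_le_errorQ hmem.abs_le)).trans ?_
      exact_mod_cast h.2.resolve_left hxd
  | const m q =>
    obtain ⟨⟨I, hI, hmem⟩, -⟩ := hR.inRange
    obtain ⟨m', hm⟩ := Option.isSome_iff_exists.1 hty
    obtain rfl : m' = m := hτ _ _ hm
    cases herr : Err (.const m' q) with
    | none => simp [checkError, hI, herr] at h
    | some err =>
    simp only [checkError, hI, herr, Bool.and_eq_true, decide_eq_true_eq] at h
    refine ⟨err, herr, h.1, ⟨q, m', .const hm (m'.rounds_self _)⟩, fun w m hw => ?_⟩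
    cases hw with
    | const _ hr =>
    refine (MType.abs_sub_le_errorQ hr hmem.abs_le).trans ?_
    exact_mod_cast h.2
  | neg e ih =>
    simp only [checkError, Bool.and_eq_true] at h
    obtain ⟨m, hm⟩ := Option.isSome_iff_exists.1 hty
    have hme : τ e = some m := hτ _ _ hm
    obtain ⟨err₁, herr₁, -, ⟨w, m', hw⟩, hs⟩ := ih hV (by simp [hme]) hR.1 h.1
    obtain rfl : m' = m := Option.some.inj (hw.type_eq.symm.trans hme)
    cases herr : Err (.neg e) with
    | none => simp [herr₁, herr] at h
    | some err =>
    simp only [herr₁, herr, Bool.and_eq_true, decide_eq_true_eq] at h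
    refine ⟨err, herr, h.2.1, ⟨_, _, .neg hm hw⟩, fun w m hw => ?_⟩
    cases hw with
    | neg _ hw =>
    simp only [realValue, ← neg_sub', abs_neg]
    exact (hs _ _ hw).trans (by exact_mod_cast h.2.2)
  | binop op e₁ e₂ ih₁ ih₂ =>
    simp only [vars, Finset.union_subset_iff] at hV
    simp only [checkError, Bool.and_eq_true] at h
    obtain ⟨m, hm⟩ := Option.isSome_iff_exists.1 hty
    obtain ⟨m₁, m₂, hm₁, hm₂, hj⟩ := hτ _ _ hm
    obtain ⟨hR₁, hR₂, -⟩ := hR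
    obtain ⟨err₁, herr₁, hn₁, ⟨w₁, m₁', hw₁⟩, hs₁⟩ := ih₁ hV.1 (by simp [hm₁]) hR₁ h.1.1
    obtain ⟨err₂, herr₂, hn₂, ⟨w₂, m₂', hw₂⟩, hs₂⟩ := ih₂ hV.2 (by simp [hm₂]) hR₂ h.1.2
    obtain rfl : m₁' = m₁ := Option.some.inj (hw₁.type_eq.symm.trans hm₁)
    obtain rfl : m₂' = m₂ := Option.some.inj (hw₂.type_eq.symm.trans hm₂)
    obtain ⟨⟨I₁, hI₁, hmem₁⟩, -⟩ := hR₁.inRange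
    obtain ⟨⟨I₂, hI₂, hmem₂⟩, -⟩ := hR₂.inRange
    cases herr : Err (.binop op e₁ e₂) with
    | none => simp [hm, hI₁, hI₂, herr₁, herr₂, herr] at h
    | some err =>
    simp only [hm, hI₁, hI₂, herr₁, herr₂, herr, Bool.and_eq_true, Bool.or_eq_true,
      decide_eq_true_eq] at h
    obtain ⟨-, ⟨hn, hz⟩, hle⟩ := h
    have h0 : op = .div → (I₂.widen err₂).noZero = true :=
      fun ho => hz.resolve_left fun hn => hn ho
    refine ⟨err, herr, hn, ⟨_, m, .binop hm hw₁ hw₂ hj (fun ho => ?_) (m.rounds_self _)⟩,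
      fun w m' hw => ?_⟩
    -- The error bound for the divisor is what makes the machine division defined.
    · exact (hmem₂.widen (hs₂ _ _ hw₂)).ne_zero (h0 ho)
    · obtain rfl : m' = m := Option.some.inj (hw.type_eq.symm.trans hm)
      cases hw with
      | binop _ hw₁ hw₂ _ _ hr =>
      exact (BinOp.abs_sub_le_errorBound hmem₁ hmem₂ (hs₁ _ _ hw₁) (hs₂ _ _ hw₂) hn₂ h0 hr).trans
        (by exact_mod_cast hle)
  | fma e₁ e₂ e₃ ih₁ ih₂ ih₃ =>
    simp only [vars, Finset.union_subset_iff] at hV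
    simp only [checkError, Bool.and_eq_true] at h
    obtain ⟨m, hm⟩ := Option.isSome_iff_exists.1 hty
    obtain ⟨m₁, m₂, m₃, hm₁, hm₂, hm₃, hj⟩ := hτ _ _ hm
    obtain ⟨hR₁, hR₂, hR₃, -⟩ := hR
    obtain ⟨err₁, herr₁, -, ⟨w₁, m₁', hw₁⟩, hs₁⟩ := ih₁ hV.1.1 (by simp [hm₁]) hR₁ h.1.1.1
    obtain ⟨err₂, herr₂, -, ⟨w₂, m₂', hw₂⟩, hs₂⟩ := ih₂ hV.1.2 (by simp [hm₂]) hR₂ h.1.1.2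
    obtain ⟨err₃, herr₃, -, ⟨w₃, m₃', hw₃⟩, hs₃⟩ := ih₃ hV.2 (by simp [hm₃]) hR₃ h.1.2
    obtain rfl : m₁' = m₁ := Option.some.inj (hw₁.type_eq.symm.trans hm₁)
    obtain rfl : m₂' = m₂ := Option.some.inj (hw₂.type_eq.symm.trans hm₂)
    obtain rfl : m₃' = m₃ := Option.some.inj (hw₃.type_eq.symm.trans hm₃)
    obtain ⟨⟨I₁, hI₁, hmem₁⟩, -⟩ := hR₁.inRange
    obtain ⟨⟨I₂, hI₂, hmem₂⟩, -⟩ := hR₂.inRange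
    obtain ⟨⟨I₃, hI₃, hmem₃⟩, -⟩ := hR₃.inRange
    cases herr : Err (.fma e₁ e₂ e₃) with
    | none => simp [hm, hI₁, hI₂, hI₃, herr₁, herr₂, herr₃, herr] at h
    | some err =>
    simp only [hm, hI₁, hI₂, hI₃, herr₁, herr₂, herr₃, herr, Bool.and_eq_true,
      decide_eq_true_eq] at h
    obtain ⟨-, hn, hle⟩ := h
    refine ⟨err, herr, hn, ⟨_, m, .fma hm hw₁ hw₂ hw₃ hj (m.rounds_self _)⟩, fun w m' hw => ?_⟩
    obtain rfl : m' = m := Option.some.inj (hw.type_eq.symm.trans hm)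
    cases hw with
    | fma _ hw₁ hw₂ hw₃ _ hr =>
    exact (abs_sub_le_fmaErrorBound hmem₁ hmem₂ hmem₃ (hs₁ _ _ hw₁) (hs₂ _ _ hw₂) (hs₃ _ _ hw₃)
      hr).trans (by exact_mod_cast hle)
  | cast m e ih =>
    simp only [checkError, Bool.and_eq_true] at h
    obtain ⟨m', hm⟩ := Option.isSome_iff_exists.1 hty
    obtain ⟨rfl, m₁, hme⟩ := hτ _ _ hm
    obtain ⟨err₁, herr₁, -, ⟨w, m₁', hw⟩, hs⟩ := ih hV (by simp [hme]) hR.1 h.1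
    obtain ⟨⟨I, hI, hmem⟩, -⟩ := hR.1.inRange
    cases herr : Err (.cast m' e) with
    | none => simp [hI, herr₁, herr] at h
    | some err =>
    simp only [hI, herr₁, herr, Bool.and_eq_true, decide_eq_true_eq] at h
    refine ⟨err, herr, h.2.1, ⟨_, _, .cast hm hw (m'.rounds_self _)⟩, fun w m hw => ?_⟩
    cases hw with
    | cast _ hw hr =>
    have hle := hs _ _ hw
    exact (abs_sub_le_add_errorQ hle (hmem.widen hle) hr).trans (by exact_mod_cast h.2.2)

/-- The real value of a function. -/
noncomputable def Cmd.realValue : Cmd → Env → ℝ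
  | .letin _ x e s, E => s.realValue (Function.update E x (some (e.realValue E)))
  | .ret e, E => e.realValue E

theorem Cmd.sound_of_validErrors {f : Cmd} (hE : EnvClose Err τ E E' V dV) (hτ : τ.Closed)
    (hV : f.isSSA V = true) (hty : f.Typed τ) (hR : f.RangeSound R τ E)
    (h : validErrors f τ R Err dV = true) :
    ∃ err, Err f.result = some err ∧ f.toReal.Eval τ.toReal E (f.realValue E) .real ∧
      (∃ v₁ m₁, f.Eval τ E' v₁ m₁) ∧
      ∀ v₂ m₂, f.Eval τ E' v₂ m₂ → |f.realValue E - v₂| ≤ (err : ℝ) := by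
  induction f generalizing E E' V dV with
  | letin m x e s ih =>
    simp only [isSSA, Bool.and_eq_true, decide_eq_true_eq] at hV
    simp only [validErrors, Bool.and_eq_true] at h
    obtain ⟨hme, hmx, hts⟩ := hty
    obtain ⟨err₁, herr₁, -, ⟨w, m', hw⟩, hs⟩ :=
      Expr.errorSound_of_checkError hE hτ hV.1.2 (by simp [hme]) hR.1 h.1.1
    obtain rfl : m' = m := Option.some.inj (hw.type_eq.symm.trans hme)
    cases herrx : Err (.var x) with
    | none => simp [herr₁, herrx] at h
    | some errx =>
    simp only [herr₁, herrx, decide_eq_true_eq] at h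
    have hle : (err₁ : ℝ) ≤ (errx : ℝ) := by exact_mod_cast h.1.2
    -- Stated for every machine value `w` of `e`: it is used for the execution being exhibited and
    -- again for an arbitrary one, which may bind a different value to `x`.
    have body {w : ℝ} (hw : e.Eval E' τ w m') :=
      ih (hE.update hmx herrx ((hs _ _ hw).trans hle)) hV.2 hts hR.2 h.2
    obtain ⟨err, herr, hv, ⟨v₁, m₁, h₁⟩, -⟩ := body hw
    refine ⟨err, herr, .letin hR.1.inRange.2 (by simp [TypeMap.toReal, hmx]) hv,
      ⟨v₁, m₁, .letin hw hmx h₁⟩, fun v₂ m₂ h₂ => ?_⟩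
    cases h₂ with
    | letin hw₂ _ h₂ =>
    obtain ⟨err', herr', -, -, hs'⟩ := body hw₂
    -- Both bounds are the entry of `Err` at the returned expression, hence independent of the
    -- chosen `w`.
    obtain rfl : err' = err := Option.some.inj (herr'.symm.trans herr)
    exact hs' _ _ h₂
  | ret e =>
    simp only [isSSA, decide_eq_true_eq] at hV
    obtain ⟨err, herr, -, ⟨w, m, hw⟩, hs⟩ := Expr.errorSound_of_checkError hE hτ hV hty hR h
    refine ⟨err, herr, .ret hR.inRange.2, ⟨w, m, .ret hw⟩, fun v₂ m₂ h₂ => ?_⟩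
    cases h₂ with
    | ret h₂ => exact hs _ _ h₂

/-- Input variables satisfy the precondition and let-bound variables have their validated ranges. -/
theorem EnvClose.envInRange {fV : Finset ℕ} {P : Precond} (hE : EnvClose Err τ E E' (fV ∪ dV) dV)
    (hP : ∀ x ∈ fV, ∀ v, E x = some v → (P x).Mem v)
    (hD : ∀ x ∈ dV, ∀ v I, E x = some v → R (.var x) = some I → I.Mem v) :
    EnvInRange P R τ E (fV ∪ dV) dV := by
  intro x hx
  obtain ⟨v, v', m, hv, -, hm, -⟩ := hE x hx
  refine ⟨by simp [hm], v, hv, ?_⟩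
  split_ifs with hxd
  · exact fun I hI => hD x hxd v I hv hI
  · exact hP x ((Finset.mem_union.1 hx).resolve_right hxd) v hv

end ErrorSound

end FloVer

theorem theorem1
    (f : FloVer.Cmd) (E E' : FloVer.Env) (fV dV : Finset ℕ)
    (P : FloVer.Precond) (Γ τ : FloVer.TypeMap)
    (R : FloVer.RangeMap) (Err : FloVer.ErrorMap)
    (hEnv : FloVer.ApproxEnv Err τ E fV dV E')
    (hP : ∀ x ∈ fV, ∀ v, E x = some v → (P x).Mem v)
    (hD : ∀ x ∈ dV, ∀ v I, E x = some v → R (.var x) = some I → I.Mem v)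
    (hSSA : f.isSSA (fV ∪ dV) = true)
    (hTypes : FloVer.validTypes Γ f = some τ)
    (hRanges : FloVer.validRanges f P R dV = true)
    (hFPRanges : FloVer.validFPRanges f τ R Err dV = true)
    (hErrors : FloVer.validErrors f τ R Err dV = true) :
    ∃ err : ℚ, Err f.result = some err ∧
      ∃ (v v₁ : ℝ) (m₁ : FloVer.MType),
        f.toReal.Eval τ.toReal E v .real ∧
        f.Eval τ E' v₁ m₁ ∧
        ∀ (v₂ : ℝ) (m₂ : FloVer.MType), f.Eval τ E' v₂ m₂ → |v - v₂| ≤ (err : ℝ) := by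
  have hClose := hEnv.envClose
  obtain ⟨hClosed, hTyped⟩ := FloVer.validTypes_sound hTypes
  have hR := FloVer.rangeSound_of_validRanges (hClose.envInRange hP hD) hSSA hTyped hRanges
  obtain ⟨err, herr, hv, ⟨v₁, m₁, h₁⟩, hs⟩ :=
    FloVer.Cmd.sound_of_validErrors hClose hClosed hSSA hTyped hR hErrors
  exact ⟨err, herr, _, v₁, m₁, hv, h₁, hs⟩
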